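/- Notation. For $g\colon\mathbb R\to[0,\infty]$ let $g^*(t)=\inf\{y\ge 0: |\{g>y\}|<t\}$, $t>0$, be its left-continuous nonincreasing rearrangement. For a measurable function $f$ on $\mathbb R^n$ and $1\le k\le n$ let $\mathcal R_kf$ be obtained by replacing, for each fixed value of the other variables, the function $x_k\mapsto |f(x)|$ by its rearrangement. For a permutation $\sigma=(k_1,\dots,k_n)$ of $\{1,\dots,n\}$ put $\mathcal R_\sigma f=\mathcal R_{k_n}\cdots\mathcal R_{k_1}f$, a function on $\mathbb R^n_+=(0,\infty)^n$. With $\pi(t)=t_1\cdots t_n$ and $0<q<\infty$, put $$\|f\|_{\mathcal L^{q,r}_\sigma}=\Big(\int_{\mathbb R^n_+}\big[\pi(t)^{1/q}\mathcal R_\sigma f(t)\big]^r\frac{dt}{\pi(t)}\Big)^{1/r}\quad(0<r<\infty),\qquad \|f\|_{\mathcal L^{q,\infty}_\sigma}=\operatorname*{ess\,sup}_{t\in\mathbb R^n_+}\pi(t)^{1/q}\mathcal R_\sigma f(t).$$ For $f\in L^p(\mathbb R^n)$ let $\omega_k(f;\delta)_p=\sup_{|h|\le\delta}\|f(\cdot+he_k)-f\|_{L^p(\mathbb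 R^n)}$. For $0<\alpha<1$ let $$\|f\|_{b^\alpha_{p,\theta;k}}=\Big(\int_0^\infty\big(t^{-\alpha}\omega_k(f;t)_p\big)^\theta\frac{dt}{t}\Big)^{1/\theta}\quad(1\le\theta<\infty),\qquad \|f\|_{b^\alpha_{p,\infty;k}}=\sup_{\delta>0}\delta^{-\alpha}\omega_k(f;\delta)_p,$$ and let $B^\alpha_{p,\theta;k}(\mathbb R^n)$ be the set of all $f\in L^p(\mathbb R^n)$ with $\|f\|_{b^\alpha_{p,\theta;k}}<\infty$. Theorem. Let $n\ge2$, $1\le p<\infty$, $p\le\theta_j\le\infty$ and $0<\beta_j<1$ for $j=1,\dots,n$. Set $$\beta=n\Big(\sum_{j=1}^n\frac1{\beta_j}\Big)^{-1},\qquad \theta=\frac n\beta\Big(\sum_{j=1}^n\frac1{\beta_j\theta_j}\Big)^{-1}$$ (with $1/\infty=0$, and $\theta=\infty$ if all $\theta_j=\infty$). Assume that $p<n/\beta$ and let $q=np/(n-\beta p)$. Then there is a constant $c>0$, depending only on $n$ and on an upper bound $Q$ for $q$, such that for every $f\in\bigcap_{j=1}^nB^{\beta_j}_{p,\theta_j;j}(\mathbb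 R^n)$ and every permutation $\sigma$ of $\{1,\dots,n\}$ $$\|f\|_{\mathcal L^{q,\theta}_\sigma}\le c\prod_{j=1}^n\Big[(1-\beta_j)^{1/\theta_j}\|f\|_{b^{\beta_j}_{p,\theta_j;j}}\Big]^{\beta/(n\beta_j)}.$$ -/

import Mathlib

open MeasureTheory
open scoped ENNReal

namespace AnisoBesov

noncomputable section

/-- Distribution function `y ↦ |{x : g x > y}|` of a nonnegative function on the line. -/
def distribution (g : ℝ → ℝ≥0∞) (y : ℝ≥0∞) : ℝ≥0∞ :=
  volume {x : ℝ | y < g x}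

/-- The left-continuous nonincreasing rearrangement `g^*(t) = inf {y ≥ 0 : |{g > y}| < t}`, `t > 0`,
of a nonnegative function on the line. It agrees with `sup_{|E| = t} inf_E g`. -/
def rearrangement (g : ℝ → ℝ≥0∞) (t : ℝ) : ℝ≥0∞ :=
  sInf {y : ℝ≥0∞ | distribution g y < ENNReal.ofReal t}

/-- Rearrangement with respect to the `k`-th variable: the section of `g` along the `k`-th
coordinate is replaced by its rearrangement. The result lives on `{x : 0 < x k}` and is
extended by `0`. -/
def partialRearrangement {n : ℕ} (k : Fin n) (g : (Fin n → ℝ) → ℝ≥0∞) (x : Fin n → ℝ) : ℝ≥0∞ :=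
  if 0 < x k then rearrangement (fun s : ℝ => g (Function.update x k s)) (x k) else 0

/-- The iterated rearrangement `R_σ f = R_{σ(n)} ⋯ R_{σ(1)} |f|` on the open positive orthant:
the variable `σ 0` is rearranged first, and the variable `σ (n - 1)` last. -/
def iteratedRearrangement {n : ℕ} (σ : Equiv.Perm (Fin n)) (f : (Fin n → ℝ) → ℝ) :
    (Fin n → ℝ) → ℝ≥0∞ :=
  (List.ofFn σ).foldl (fun g k => partialRearrangement k g) (fun x => ‖f x‖ₑ)

/-- The open positive orthant `ℝ^n_+`. -/
def posOrthant (n : ℕ) : Set (Fin n → ℝ) := {t | ∀ i, 0 < t i}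

/-- The modified Lorentz norm
`(∫_{ℝ^n_+} (π(t)^{1/q} R_σ f(t))^r dt/π(t))^{1/r}`, `π(t) = t_1 ⋯ t_n`, with the (essential)
supremum of `π(t)^{1/q} R_σ f(t)` for `r = ∞`. -/
def modLorentzNorm {n : ℕ} (q : ℝ) (r : ℝ≥0∞) (σ : Equiv.Perm (Fin n))
    (f : (Fin n → ℝ) → ℝ) : ℝ≥0∞ :=
  if r = ∞ then
    essSup (fun t => ENNReal.ofReal ((∏ i, t i) ^ (1 / q)) * iteratedRearrangement σ f t)
      (volume.restrict (posOrthant n))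
  else
    (∫⁻ t in posOrthant n,
      (ENNReal.ofReal ((∏ i, t i) ^ (1 / q)) * iteratedRearrangement σ f t) ^ r.toReal
        / ENNReal.ofReal (∏ i, t i)) ^ (1 / r.toReal)

/-- The partial modulus of continuity
`ω_k(f; δ)_p = sup_{|h| ≤ δ} ‖f(· + h e_k) - f‖_p`. -/
def partialModulus {n : ℕ} (p : ℝ) (k : Fin n) (f : (Fin n → ℝ) → ℝ) (δ : ℝ) : ℝ≥0∞ :=
  ⨆ (h : ℝ) (_ : |h| ≤ δ),
    eLpNorm (fun x => f (x + Pi.single k h) - f x) (ENNReal.ofReal p) volume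

/-- The partial Besov seminorm `‖f‖_{b^α_{p,θ;k}}`, that is
`(∫_0^∞ (t^{-α} ω_k(f;t)_p)^θ dt/t)^{1/θ}` for `θ < ∞`, and
`sup_{δ>0} ω_k(f;δ)_p / δ^α` for `θ = ∞`. -/
def besovSeminorm {n : ℕ} (α p : ℝ) (θ : ℝ≥0∞) (k : Fin n) (f : (Fin n → ℝ) → ℝ) : ℝ≥0∞ :=
  if θ = ∞ then
    ⨆ (δ : ℝ) (_ : 0 < δ), partialModulus p k f δ / ENNReal.ofReal (δ ^ α)
  else
    (∫⁻ t in Set.Ioi (0 : ℝ),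
      (ENNReal.ofReal (t ^ (-α)) * partialModulus p k f t) ^ θ.toReal
        / ENNReal.ofReal t) ^ (1 / θ.toReal)

/-- Membership in the partial Besov space `B^α_{p,θ;k}(ℝ^n)`. -/
def MemBesov {n : ℕ} (α p : ℝ) (θ : ℝ≥0∞) (k : Fin n) (f : (Fin n → ℝ) → ℝ) : Prop :=
  MemLp f (ENNReal.ofReal p) volume ∧ besovSeminorm α p θ k f < ∞

end

end AnisoBesov

open AnisoBesov

/-!
Write `F` for the iterated rearrangement of `f`. It is nonincreasing in each variable, so its size
near `t` is controlled by its `L^p` norm over the dyadic box just below `t`. Passing from a box to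
its double in direction `k` costs the `L^p` norm of the decrease of `F` under doubling of the `k`-th
coordinate, and these norms are controlled by `ω_k(f; ·)_p`.

In one variable this rests on an exit argument: if `g^*` drops from `a` to `b` over a cell of length
`δ`, then a set of measure at least `δ / 2` of points of `{g ≥ a}` leaves `{g > b}` under at least
half of the shifts `u ∈ (0, 4δ)`. Hence `δ^2` times the sum of the `p`-th powers of the drops over a
grid of step `δ` is at most the integral over these shifts of `‖(g - g(· + u))₊‖_p^p`. Since
rearrangement contracts the `L^p` distance, also in its one-sided form, the rearrangements in the
other variables do no harm.

The factor `(1 - β_k)^{1/θ_k}` appears on integrating over `δ` the bound obtained at each scale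
`δ`: a box of side `2^{ν_k}` in direction `k` contributes for `δ ≤ 2^{ν_k}` with a weight
proportional to `δ / 2^{ν_k}`, and the resulting integral is of order `1 / (1 - β_k)`.

At every box one doubles in the direction whose decrease is smallest, hence at most the weighted
geometric mean of the decreases in all directions. Once the decreases are replaced by majorants that
vary slowly from box to box, the resulting series is dominated by its first term, and Hölder's
inequality over the boxes gives the product of the Besov seminorms.
-/

namespace AnisoBesov

open Set

section Rearrangement

variable {g h : ℝ → ℝ≥0∞} {t : ℝ} {y : ℝ≥0∞}

lemma distribution_antitone (g : ℝ → ℝ≥0∞) : Antitone (distribution g) :=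
  fun _ _ hy => measure_mono fun _ hx => hy.trans_lt hx

lemma rearrangement_antitone (g : ℝ → ℝ≥0∞) : Antitone (rearrangement g) :=
  fun _ _ ht => sInf_le_sInf fun _ hy => hy.trans_le (ENNReal.ofReal_le_ofReal ht)

lemma measurable_rearrangement (g : ℝ → ℝ≥0∞) : Measurable (rearrangement g) :=
  (rearrangement_antitone g).measurable

lemma rearrangement_mono (hgh : g ≤ h) : rearrangement g ≤ rearrangement h :=
  fun _ => sInf_le_sInf fun _ hy => (measure_mono fun x hx => hx.trans_le (hgh x)).trans_lt hy

lemma rearrangement_congr_ae (hgh : g =ᵐ[volume] h) : rearrangement g = rearrangement h := by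
  have hdist : distribution g = distribution h :=
    funext fun y => measure_congr <| hgh.mono fun x hx => congrArg (y < ·) hx
  funext t
  rw [rearrangement, rearrangement, hdist]

lemma rearrangement_zero (ht : 0 < t) : rearrangement (fun _ => 0) t = 0 :=
  le_antisymm (sInf_le <| by simp [distribution, ht]) bot_le

lemma rearrangement_add_const_le (g : ℝ → ℝ≥0∞) (s : ℝ≥0∞) (t : ℝ) :
    rearrangement (fun x => g x + s) t ≤ rearrangement g t + s := by
  rw [rearrangement, rearrangement, ENNReal.sInf_add]
  refine le_iInf₂ fun y hy => sInf_le ?_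
  exact (measure_mono fun x (hx : y + s < g x + s) => lt_of_add_lt_add_right hx).trans_lt hy

lemma le_distribution_of_lt_rearrangement (hy : y < rearrangement g t) :
    ENNReal.ofReal t ≤ distribution g y :=
  not_lt.1 fun hlt => hy.not_ge (sInf_le hlt)

lemma lt_rearrangement_of_lt_distribution (hy : ENNReal.ofReal t < distribution g y) :
    y < rearrangement g t := by
  have hy_top : y < ∞ := lt_top_iff_ne_top.2 <| by rintro rfl; simp [distribution] at hy
  obtain ⟨u, hu, hyu, hlim⟩ := exists_seq_strictAnti_tendsto' hy_top
  have hunion : {x | y < g x} = ⋃ i, {x | u i < g x} := by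
    ext x
    simp only [mem_ofPred_eq, mem_iUnion]
    exact ⟨fun hx => (hlim.eventually (gt_mem_nhds hx)).exists, fun ⟨i, hi⟩ => (hyu i).1.trans hi⟩
  have hmono : Monotone fun i => {x | u i < g x} := fun _ _ hij _ hx =>
    (hu.antitone hij).trans_lt hx
  rw [distribution, hunion, hmono.measure_iUnion] at hy
  obtain ⟨i, hi⟩ := lt_iSup_iff.1 hy
  refine (hyu i).1.trans_le (le_sInf fun z hz => ?_)
  exact not_lt.1 fun hzu => (hi.trans_le (distribution_antitone g hzu.le)).not_gt hz

lemma distribution_rearrangement_le (g : ℝ → ℝ≥0∞) (t : ℝ) :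
    distribution g (rearrangement g t) ≤ ENNReal.ofReal t :=
  not_lt.1 fun hlt => lt_irrefl _ (lt_rearrangement_of_lt_distribution hlt)

lemma ofReal_le_volume_rearrangement_le (hg : Measurable g) (hy : y < rearrangement g t)
    (hfin : distribution g y ≠ ∞) : ENNReal.ofReal t ≤ volume {x | rearrangement g t ≤ g x} := by
  obtain ⟨u, hu, hyu, hlim⟩ := exists_seq_strictMono_tendsto' hy
  have hinter : {x | rearrangement g t ≤ g x} = ⋂ i, {x | u i < g x} := by
    ext x
    simp only [mem_ofPred_eq, mem_iInter]
    exact ⟨fun hx i => (hyu i).2.trans_le hx, fun hx => le_of_tendsto' hlim fun i => (hx i).le⟩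
  have hanti : Antitone fun i => {x | u i < g x} := fun _ _ hij _ hx =>
    (hu.monotone hij).trans_lt hx
  rw [hinter, hanti.measure_iInter
    (fun i => (measurableSet_lt measurable_const hg).nullMeasurableSet)
    ⟨0, ne_top_of_le_ne_top hfin (distribution_antitone g (hyu 0).1.le)⟩]
  exact le_iInf fun i => le_distribution_of_lt_rearrangement (hyu i).2

end Rearrangement

section Contraction

lemma volume_Ioi_inter_preimage_ofReal_Icc (a b : ℝ≥0∞) :
    volume (Ioi 0 ∩ ENNReal.ofReal ⁻¹' Icc b a) = a - b := by
  induction b using ENNReal.recTopCoe with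
  | top => simp [inter_def]
  | coe b =>
    have mem_iff {y : ℝ} (hy : 0 < y) : (b : ℝ≥0∞) ≤ ENNReal.ofReal y ↔ (b : ℝ) ≤ y := by
      rw [ENNReal.coe_nnreal_eq, ENNReal.ofReal_le_ofReal_iff hy.le]
    induction a using ENNReal.recTopCoe with
    | top =>
      rw [ENNReal.top_sub_coe, ← top_le_iff]
      refine (Real.volume_Ioi (a := b)).symm.le.trans ?_
      refine measure_mono fun y (hy : (b : ℝ) < y) => ?_
      have hy0 : 0 < y := b.coe_nonneg.trans_lt hy
      exact ⟨hy0, (mem_iff hy0).2 hy.le, ENNReal.ofReal_lt_top.le⟩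
    | coe a =>
      have hset : Ioi 0 ∩ ENNReal.ofReal ⁻¹' Icc b a = Ioi 0 ∩ Icc (b : ℝ) a := by
        ext y
        refine and_congr_right fun (hy : 0 < y) => and_congr (mem_iff hy) ?_
        rw [ENNReal.coe_nnreal_eq, ENNReal.ofReal_le_ofReal_iff a.coe_nonneg]
      have hvol : volume (Icc (b : ℝ) a) = a - b := by
        rw [Real.volume_Icc, ENNReal.ofReal_sub _ b.coe_nonneg, ENNReal.ofReal_coe_nnreal,
          ENNReal.ofReal_coe_nnreal]
      rw [hset, ← hvol]
      refine le_antisymm (measure_mono inter_subset_right) ?_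
      rw [← measure_congr Ioc_ae_eq_Icc]
      exact measure_mono fun y hy => ⟨b.coe_nonneg.trans_lt hy.1, Ioc_subset_Icc_self hy⟩

lemma volume_Ioi_inter_preimage_ofReal_Ico (a b : ℝ≥0∞) :
    volume (Ioi 0 ∩ ENNReal.ofReal ⁻¹' Ico b a) = a - b := by
  rw [← volume_Ioi_inter_preimage_ofReal_Icc]
  refine measure_congr ?_
  filter_upwards [Measure.ae_ne volume a.toReal] with y hy
  refine propext <| and_congr_right fun (hy0 : 0 < y) => and_congr_right fun _ =>
    ⟨le_of_lt, fun hya => hya.lt_of_ne fun heq => hy ?_⟩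
  rw [← heq, ENNReal.toReal_ofReal hy0.le]

lemma lintegral_tsub_eq_lintegral_measure {α : Type*} [MeasurableSpace α] {μ : Measure α}
    [SFinite μ] {g h : α → ℝ≥0∞} (hg : Measurable g) (hh : Measurable h) :
    ∫⁻ x, (g x - h x) ∂μ =
      ∫⁻ y in Ioi (0 : ℝ), μ {x | h x ≤ ENNReal.ofReal y ∧ ENNReal.ofReal y < g x} := by
  have hS : MeasurableSet
      {z : α × ℝ | h z.1 ≤ ENNReal.ofReal z.2 ∧ ENNReal.ofReal z.2 < g z.1} :=
    (measurableSet_le (hh.comp measurable_fst) (by fun_prop)).inter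
      (measurableSet_lt (by fun_prop) (hg.comp measurable_fst))
  refine Eq.trans ?_ <| (Measure.prod_apply hS).symm.trans <| Measure.prod_apply_symm hS
  refine lintegral_congr fun x => ?_
  rw [Measure.restrict_apply (measurable_prodMk_left hS), inter_comm,
    ← volume_Ioi_inter_preimage_ofReal_Ico]
  rfl

lemma lintegral_rearrangement_tsub_le {g h : ℝ → ℝ≥0∞} (hg : Measurable g) (hh : Measurable h) :
    ∫⁻ t in Ioi (0 : ℝ), (rearrangement g t - rearrangement h t) ≤ ∫⁻ x, (g x - h x) := by
  rw [lintegral_tsub_eq_lintegral_measure (measurable_rearrangement g) (measurable_rearrangement h),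
    lintegral_tsub_eq_lintegral_measure hg hh]
  refine lintegral_mono fun y => ?_
  rw [Measure.restrict_apply' measurableSet_Ioi]
  calc _ ≤ volume (Ioi 0 ∩ ENNReal.ofReal ⁻¹'
          Icc (distribution h (ENNReal.ofReal y)) (distribution g (ENNReal.ofReal y))) := by
        refine measure_mono ?_
        rintro t ⟨⟨hle, hlt⟩, ht⟩
        refine ⟨ht, ?_, ?_⟩
        · exact (distribution_antitone h hle).trans (distribution_rearrangement_le h t)
        · exact le_distribution_of_lt_rearrangement hlt
    _ = distribution g (ENNReal.ofReal y) - distribution h (ENNReal.ofReal y) :=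
        volume_Ioi_inter_preimage_ofReal_Icc _ _
    _ ≤ volume ({x | ENNReal.ofReal y < g x} \ {x | ENNReal.ofReal y < h x}) := le_measure_sdiff
    _ ≤ volume {x | h x ≤ ENNReal.ofReal y ∧ ENNReal.ofReal y < g x} :=
        measure_mono fun x hx => And.intro (not_lt.1 hx.2) hx.1

lemma integral_rpow_mul_sub {p x : ℝ} (hp : 1 < p) (hx : 0 < x) :
    ∫ s in (0 : ℝ)..x, p * (p - 1) * s ^ (p - 2) * (x - s) = x ^ p := by
  have hsplit : EqOn (fun s : ℝ => p * (p - 1) * s ^ (p - 2) * (x - s))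
      (fun s => p * (p - 1) * x * s ^ (p - 2) - p * (p - 1) * s ^ (p - 1)) (Ioo 0 x) := by
    intro s hs
    have : s ^ (p - 1) = s ^ (p - 2) * s := by rw [← Real.rpow_add_one hs.1.ne']; ring_nf
    beta_reduce
    rw [this]
    ring
  rw [intervalIntegral.integral_congr_Ioo_of_le hx.le hsplit, intervalIntegral.integral_sub
    ((intervalIntegral.intervalIntegrable_rpow' (by linarith)).const_mul _)
    ((intervalIntegral.intervalIntegrable_rpow' (by linarith)).const_mul _),
    intervalIntegral.integral_const_mul, intervalIntegral.integral_const_mul,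
    integral_rpow (Or.inl (by linarith)), integral_rpow (Or.inl (by linarith)),
    show p - 2 + 1 = p - 1 by ring, sub_add_cancel, Real.zero_rpow (by linarith),
    Real.zero_rpow (by linarith), show x ^ p = x ^ (p - 1) * x by
      rw [← Real.rpow_add_one hx.ne', sub_add_cancel]]
  have : p - 1 ≠ 0 := by linarith
  field_simp
  ring

lemma lintegral_rpow_mul_tsub_ofReal {p x : ℝ} (hp : 1 < p) (hx : 0 < x) :
    ∫⁻ s in Ioi (0 : ℝ), ENNReal.ofReal (p * (p - 1) * s ^ (p - 2)) *
      (ENNReal.ofReal x - ENNReal.ofReal s) = ENNReal.ofReal x ^ p := by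
  have hweight {s : ℝ} (hs : 0 < s) : 0 ≤ p * (p - 1) * s ^ (p - 2) := by
    have : 0 < p - 1 := by linarith
    positivity
  have hval := integral_rpow_mul_sub hp hx
  rw [intervalIntegral.integral_of_le hx.le] at hval
  have hintegrable : IntegrableOn (fun s => p * (p - 1) * s ^ (p - 2) * (x - s)) (Ioc 0 x) :=
    .of_integral_ne_zero (by rw [hval]; positivity)
  have hzero : ∫⁻ s in Ioi x, ENNReal.ofReal (p * (p - 1) * s ^ (p - 2)) *
      (ENNReal.ofReal x - ENNReal.ofReal s) = 0 := by
    rw [setLIntegral_congr_fun (g := fun _ => 0) measurableSet_Ioi, lintegral_zero]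
    intro s hs
    beta_reduce
    rw [tsub_eq_zero_of_le (ENNReal.ofReal_le_ofReal (le_of_lt hs)), mul_zero]
  rw [← Ioc_union_Ioi_eq_Ioi hx.le, lintegral_union measurableSet_Ioi (Ioc_disjoint_Ioi le_rfl),
    hzero, add_zero, ENNReal.ofReal_rpow_of_pos hx, ← hval,
    ofReal_integral_eq_lintegral_ofReal hintegrable]
  · refine setLIntegral_congr_fun measurableSet_Ioc fun s hs => ?_
    rw [← ENNReal.ofReal_sub _ hs.1.le, ← ENNReal.ofReal_mul (hweight hs.1)]
  · filter_upwards [ae_restrict_mem measurableSet_Ioc] with s hs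
    exact mul_nonneg (hweight hs.1) (sub_nonneg.2 hs.2)

lemma lintegral_rpow_mul_tsub {p : ℝ} (hp : 1 < p) (x : ℝ≥0∞) :
    ∫⁻ s in Ioi (0 : ℝ), ENNReal.ofReal (p * (p - 1) * s ^ (p - 2)) *
      (x - ENNReal.ofReal s) = x ^ p := by
  have hp0 : 0 < p := by linarith
  rcases eq_or_ne x ∞ with rfl | hx
  · rw [ENNReal.top_rpow_of_pos hp0]
    refine ENNReal.eq_top_of_forall_nnreal_le fun r => ?_
    have hr : (0 : ℝ) < r + 1 := by positivity
    calc (r : ℝ≥0∞) ≤ ENNReal.ofReal (r + 1) := by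
          rw [ENNReal.coe_nnreal_eq]
          exact ENNReal.ofReal_le_ofReal (by linarith)
      _ ≤ ENNReal.ofReal (r + 1) ^ p :=
          ENNReal.le_rpow_self_of_one_le (ENNReal.one_le_ofReal.2 (by linarith [r.2])) hp.le
      _ = _ := (lintegral_rpow_mul_tsub_ofReal hp hr).symm
      _ ≤ _ := lintegral_mono fun s => by gcongr; exact le_top
  · rcases eq_or_ne x 0 with rfl | hx0
    · simp [hp0]
    · rw [← ENNReal.ofReal_toReal hx]
      exact lintegral_rpow_mul_tsub_ofReal hp (ENNReal.toReal_pos hx0 hx)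

lemma lintegral_tsub_rpow_eq {α : Type*} [MeasurableSpace α] {μ : Measure α} [SFinite μ]
    {g h : α → ℝ≥0∞} (hg : Measurable g) (hh : Measurable h) {p : ℝ} (hp : 1 < p) :
    ∫⁻ x, (g x - h x) ^ p ∂μ = ∫⁻ s in Ioi (0 : ℝ),
      ENNReal.ofReal (p * (p - 1) * s ^ (p - 2)) * ∫⁻ x, (g x - (h x + ENNReal.ofReal s)) ∂μ := by
  simp_rw [← lintegral_rpow_mul_tsub hp]
  rw [lintegral_lintegral_swap (Measurable.aemeasurable (by fun_prop))]
  refine lintegral_congr fun s => ?_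
  rw [lintegral_const_mul _ (by fun_prop)]
  simp_rw [tsub_tsub]

-- The powers `(x - s)₊` span `x ^ p` by positive weights, so the case `p = 1` suffices.
theorem lintegral_rearrangement_tsub_rpow_le {g h : ℝ → ℝ≥0∞} (hg : Measurable g)
    (hh : Measurable h) {p : ℝ} (hp : 1 ≤ p) :
    ∫⁻ t in Ioi (0 : ℝ), (rearrangement g t - rearrangement h t) ^ p ≤ ∫⁻ x, (g x - h x) ^ p := by
  rcases eq_or_lt_of_le hp with rfl | hp
  · simpa using lintegral_rearrangement_tsub_le hg hh
  rw [lintegral_tsub_rpow_eq (measurable_rearrangement g) (measurable_rearrangement h) hp,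
    lintegral_tsub_rpow_eq hg hh hp]
  refine lintegral_mono fun s => mul_le_mul' le_rfl ?_
  calc _ ≤ ∫⁻ t in Ioi (0 : ℝ),
          (rearrangement g t - rearrangement (fun x => h x + ENNReal.ofReal s) t) :=
        lintegral_mono fun t => tsub_le_tsub_left (rearrangement_add_const_le h _ t) _
    _ ≤ _ := lintegral_rearrangement_tsub_le hg (by fun_prop)

end Contraction

section Translates

open Filter in
lemma exists_measure_Ioi_eq {μ : Measure ℝ} [IsFiniteMeasure μ] [NullSingletonClass μ] {c : ℝ≥0∞}
    (hc : 0 < c) (hcμ : c < μ univ) : ∃ s, μ (Ioi s) = c := by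
  have hcont : Continuous fun s => μ (Ioi s) := by
    refine continuous_iff_continuousAt.2 fun a => ?_
    have hprim : ContinuousOn (fun s => ∫ _ in Ioi s, (1 : ℝ) ∂μ) (Ici (a - 1)) :=
      IntegrableOn.continuousOn_Ici_primitive_Ioi (integrable_const 1).integrableOn
    simpa [Function.comp_def] using ENNReal.continuous_ofReal.continuousAt.comp
      (hprim.continuousAt (Ici_mem_nhds (sub_one_lt a)))
  have hlarge : ∀ᶠ s in atBot, c < μ (Ioi s) :=
    (tendsto_measure_iUnion_atBot (s := Ioi) antitone_Ioi).eventually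
      (lt_mem_nhds (by rwa [iUnion_Ioi]))
  have hsmall : ∀ᶠ s in atTop, μ (Ioi s) < c := by
    refine (tendsto_measure_iInter_atTop (s := Ioi) (fun s => measurableSet_Ioi.nullMeasurableSet)
      antitone_Ioi ⟨0, measure_ne_top _ _⟩).eventually (gt_mem_nhds ?_)
    have hempty : ⋂ s : ℝ, Ioi s = ∅ :=
      eq_empty_of_forall_notMem fun x hx => lt_irrefl x (mem_iInter.1 hx x)
    rwa [hempty, measure_empty]
  exact mem_range_of_exists_le_of_exists_ge hcont (hsmall.exists.imp fun _ => le_of_lt)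
    (hlarge.exists.imp fun _ => le_of_lt)

lemma measurableSet_exit_pairs {A B : Set ℝ} (hA : MeasurableSet A) (hB : MeasurableSet B) :
    MeasurableSet {z : ℝ × ℝ | z.2 ∈ A ∧ z.2 + z.1 ∉ B} :=
  (measurable_snd hA).inter ((measurable_snd.add measurable_fst) hB).compl

lemma le_volume_exit_translates {B : Set ℝ} {s x r v : ℝ} (hx : s < x)
    (hB : volume (B ∩ Ioi s) ≤ ENNReal.ofReal v) (hv : 0 ≤ v) :
    ENNReal.ofReal (r - v) ≤ volume ({u | x + u ∉ B} ∩ Ioo 0 r) := by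
  have hsub : Ioo 0 r \ ((fun u => x + u) ⁻¹' (B ∩ Ioi s)) ⊆ {u | x + u ∉ B} ∩ Ioo 0 r :=
    fun u hu => ⟨fun hxu => hu.2 ⟨hxu, by simpa using hx.trans (by linarith [hu.1.1])⟩, hu.1⟩
  calc ENNReal.ofReal (r - v) = ENNReal.ofReal (r - 0) - ENNReal.ofReal v := by
        rw [sub_zero, ENNReal.ofReal_sub _ hv]
    _ ≤ volume (Ioo 0 r) - volume ((fun u => x + u) ⁻¹' (B ∩ Ioi s)) := by
        rw [Real.volume_Ioo, measure_preimage_add]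
        exact tsub_le_tsub_left hB _
    _ ≤ _ := le_measure_sdiff.trans (measure_mono hsub)

-- Beyond a suitable point `s` there is still `h / 2` of `A` but at most `2 * h` of `B`, so every
-- `x ∈ A` to the right of `s` leaves `B` for at least `2 * h` of the `u ∈ (0, 4 * h)`.
lemma sq_le_lintegral_volume_exit {A B : Set ℝ} (hA : MeasurableSet A) (hB : MeasurableSet B)
    (hAB : A ⊆ B) (hAfin : volume A ≠ ∞) {h : ℝ} (hh : 0 < h) (hAh : ENNReal.ofReal h ≤ volume A)
    (hBA : volume B ≤ volume A + ENNReal.ofReal h) :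
    ENNReal.ofReal (h ^ 2) ≤ ∫⁻ u in Ioo 0 (4 * h), volume {x | x ∈ A ∧ x + u ∉ B} := by
  have := isFiniteMeasure_restrict.2 hAfin
  obtain ⟨s, hs⟩ := exists_measure_Ioi_eq (μ := volume.restrict A) (c := ENNReal.ofReal (h / 2))
    (by positivity) (by
      rw [Measure.restrict_apply_univ]
      exact ((ENNReal.ofReal_lt_ofReal_iff hh).2 (by linarith)).trans_le hAh)
  rw [Measure.restrict_apply measurableSet_Ioi, inter_comm] at hs
  have hBs : volume (B ∩ Ioi s) ≤ ENNReal.ofReal (2 * h) :=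
    calc volume (B ∩ Ioi s) ≤ volume (A ∩ Ioi s ∪ B \ A) := by
          refine measure_mono fun x hx => ?_
          by_cases hxA : x ∈ A
          exacts [Or.inl ⟨hxA, hx.2⟩, Or.inr ⟨hx.1, hxA⟩]
      _ ≤ ENNReal.ofReal (h / 2) + ENNReal.ofReal h := by
          refine (measure_union_le _ _).trans (add_le_add hs.le ?_)
          rw [measure_sdiff hAB hA.nullMeasurableSet hAfin]
          exact tsub_le_iff_left.2 hBA
      _ ≤ _ := by
          rw [← ENNReal.ofReal_add (by positivity) hh.le]
          exact ENNReal.ofReal_le_ofReal (by linarith)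
  have hS := measurableSet_exit_pairs hA hB
  calc ENNReal.ofReal (h ^ 2) = ENNReal.ofReal (4 * h - 2 * h) * volume (A ∩ Ioi s) := by
        rw [hs, ← ENNReal.ofReal_mul (by linarith)]; ring_nf
    _ = ∫⁻ _ in A ∩ Ioi s, ENNReal.ofReal (4 * h - 2 * h) := by rw [setLIntegral_const]
    _ ≤ ∫⁻ x in A ∩ Ioi s, volume.restrict (Ioo 0 (4 * h)) {u | x ∈ A ∧ x + u ∉ B} := by
        refine setLIntegral_mono' (hA.inter measurableSet_Ioi) fun x hx => ?_
        simp only [hx.1, true_and]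
        exact (le_volume_exit_translates hx.2 hBs (by positivity)).trans
          (Measure.le_restrict_apply _ _)
    _ ≤ ∫⁻ x, volume.restrict (Ioo 0 (4 * h)) {u | x ∈ A ∧ x + u ∉ B} :=
        setLIntegral_le_lintegral _ _
    _ = _ := (Measure.prod_apply_symm hS).symm.trans (Measure.prod_apply hS)

lemma sum_Ico_tsub_succ {c : ℕ → ℝ≥0∞} (hc : Antitone c) {m n : ℕ} (hmn : m ≤ n) :
    ∑ i ∈ Finset.Ico m n, (c i - c (i + 1)) = c m - c n := by
  induction n, hmn using Nat.le_induction with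
  | base => simp
  | succ n hmn ih =>
    rw [Finset.sum_Ico_succ_top hmn, ih, tsub_add_tsub_cancel (hc hmn) (hc n.le_succ)]

lemma tsum_rpow_le_rpow_tsum {ι : Type*} (f : ι → ℝ≥0∞) {p : ℝ} (hp : 1 ≤ p) :
    ∑' i, f i ^ p ≤ (∑' i, f i) ^ p := by
  refine ENNReal.summable.tsum_le_of_sum_le fun s => le_trans ?_
    (ENNReal.rpow_le_rpow (ENNReal.sum_le_tsum s) (by positivity))
  induction s using Finset.cons_induction with
  | empty => simp
  | cons i s hi ih =>
    rw [Finset.sum_cons, Finset.sum_cons]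
    exact (add_le_add_right ih _).trans (ENNReal.add_rpow_le_rpow_add _ _ hp)

lemma tsum_level_gaps_le {a : ℕ → ℝ≥0∞} (ha : Antitone a) (G H : ℝ≥0∞) :
    ∑' i, (if a i ≤ G ∧ H ≤ a (i + 1) then a i - a (i + 1) else 0) ≤ G - H := by
  have hsucc : ∀ i, a (i + 1) ≤ a i := fun i => ha i.le_succ
  rcases le_or_gt H G with hHG | hGH
  · refine ENNReal.tsum_le_of_sum_range_le fun N => ?_
    set c : ℕ → ℝ≥0∞ := fun i => max H (min (a i) G)
    have hc : Antitone c := fun i j hij => max_le_max le_rfl (min_le_min (ha hij) le_rfl)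
    calc _ ≤ ∑ i ∈ Finset.Ico 0 N, (c i - c (i + 1)) := by
          rw [← Finset.range_eq_Ico]
          refine Finset.sum_le_sum fun i _ => ?_
          split_ifs with hi
          · simp only [c]
            rw [min_eq_left hi.1, min_eq_left ((hsucc i).trans hi.1), max_eq_right hi.2,
              max_eq_right (hi.2.trans (hsucc i))]
          · exact bot_le
      _ = c 0 - c N := sum_Ico_tsub_succ hc N.zero_le
      _ ≤ G - H := tsub_le_tsub (max_le hHG (min_le_right _ _)) (le_max_left _ _)
  · have : ∀ i, ¬(a i ≤ G ∧ H ≤ a (i + 1)) := fun i hi =>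
      (hi.2.trans ((hsucc i).trans hi.1)).not_gt hGH
    simp [this]

lemma tsum_level_gaps_rpow_le {a : ℕ → ℝ≥0∞} (ha : Antitone a) (G H : ℝ≥0∞) {p : ℝ}
    (hp : 1 ≤ p) :
    ∑' i, (if a i ≤ G ∧ H ≤ a (i + 1) then (a i - a (i + 1)) ^ p else 0) ≤ (G - H) ^ p := by
  have hp0 : 0 < p := by positivity
  calc _ = ∑' i, (if a i ≤ G ∧ H ≤ a (i + 1) then a i - a (i + 1) else 0) ^ p :=
        tsum_congr fun i => by split_ifs <;> simp [hp0]
    _ ≤ _ := (tsum_rpow_le_rpow_tsum _ hp).trans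
        (ENNReal.rpow_le_rpow (tsum_level_gaps_le ha G H) hp0.le)

/-- The drop of `g^*` over the `i`-th cell of the grid of step `h`, counted from `t = h` on. -/
noncomputable def gridGap (g : ℝ → ℝ≥0∞) (h : ℝ) (i : ℕ) : ℝ≥0∞ :=
  rearrangement g ((i + 1) * h) - rearrangement g ((i + 2) * h)

lemma antitone_rearrangement_grid (g : ℝ → ℝ≥0∞) {h : ℝ} (hh : 0 ≤ h) :
    Antitone fun i : ℕ => rearrangement g ((i + 1) * h) := fun i j hij =>
  rearrangement_antitone g (by gcongr)

lemma gridGap_eq (g : ℝ → ℝ≥0∞) (h : ℝ) (i : ℕ) :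
    gridGap g h i =
      rearrangement g ((i + 1) * h) - rearrangement g (((i + 1 : ℕ) + 1) * h) := by
  rw [gridGap]
  push_cast
  ring_nf

lemma sq_le_lintegral_volume_gap {g : ℝ → ℝ≥0∞} (hg : Measurable g) {h t : ℝ} (hh : 0 < h)
    (ht : h ≤ t) (hlt : rearrangement g (t + h) < rearrangement g t) :
    ENNReal.ofReal (h ^ 2) ≤ ∫⁻ u in Ioo 0 (4 * h),
      volume {x | rearrangement g t ≤ g x ∧ g (x + u) ≤ rearrangement g (t + h)} := by
  set A := {x | rearrangement g t ≤ g x}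
  set B := {x | rearrangement g (t + h) < g x}
  have hAB : A ⊆ B := fun x hx => hlt.trans_le hx
  have hB : volume B ≤ ENNReal.ofReal (t + h) := distribution_rearrangement_le g _
  have hBfin : volume B ≠ ∞ := ne_top_of_le_ne_top ENNReal.ofReal_ne_top hB
  have hA : ENNReal.ofReal t ≤ volume A := ofReal_le_volume_rearrangement_le hg hlt hBfin
  have hBA : volume B ≤ volume A + ENNReal.ofReal h := by
    refine hB.trans (le_trans ?_ (add_le_add_left hA _))
    rw [ENNReal.ofReal_add (hh.le.trans ht) hh.le]
  simpa only [A, B, mem_ofPred_eq, not_lt] using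
    sq_le_lintegral_volume_exit (measurableSet_le measurable_const hg)
      (measurableSet_lt measurable_const hg) hAB (ne_top_of_le_ne_top hBfin (measure_mono hAB)) hh
      ((ENNReal.ofReal_le_ofReal ht).trans hA) hBA

lemma measurable_level_gap {g : ℝ → ℝ≥0∞} (hg : Measurable g) (b c d : ℝ≥0∞) :
    Measurable fun z : ℝ × ℝ => if b ≤ g z.2 ∧ g (z.2 + z.1) ≤ c then d else 0 := by
  refine Measurable.ite (.inter ?_ ?_) measurable_const measurable_const
  · exact measurableSet_le measurable_const (hg.comp measurable_snd)
  · exact measurableSet_le (hg.comp (measurable_snd.add measurable_fst)) measurable_const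

lemma sq_mul_gridGap_rpow_le {g : ℝ → ℝ≥0∞} (hg : Measurable g) {h : ℝ} (hh : 0 < h) {p : ℝ}
    (hp : 0 < p) (i : ℕ) :
    ENNReal.ofReal (h ^ 2) * gridGap g h i ^ p ≤ ∫⁻ u in Ioo 0 (4 * h), ∫⁻ x,
      if rearrangement g ((i + 1) * h) ≤ g x ∧
        g (x + u) ≤ rearrangement g (((i + 1 : ℕ) + 1) * h) then gridGap g h i ^ p else 0 := by
  rw [gridGap_eq]
  set a := rearrangement g ((i + 1) * h)
  set b := rearrangement g (((i + 1 : ℕ) + 1) * h) with hb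
  rcases le_or_gt a b with hab | hab
  · simp [tsub_eq_zero_of_le hab, hp]
  have hexit : ENNReal.ofReal (h ^ 2) ≤
      ∫⁻ u in Ioo 0 (4 * h), volume {x | a ≤ g x ∧ g (x + u) ≤ b} := by
    have hsucc : ((i + 1 : ℕ) + 1 : ℝ) * h = (i + 1) * h + h := by push_cast; ring
    rw [hb, hsucc] at hab ⊢
    exact sq_le_lintegral_volume_gap hg hh (by nlinarith [i.cast_nonneg (α := ℝ)]) hab
  calc _ ≤ (∫⁻ u in Ioo 0 (4 * h), volume {x | a ≤ g x ∧ g (x + u) ≤ b}) * (a - b) ^ p := by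
        gcongr
    _ ≤ ∫⁻ u in Ioo 0 (4 * h), volume {x | a ≤ g x ∧ g (x + u) ≤ b} * (a - b) ^ p :=
        lintegral_mul_const_le _ _
    _ = ∫⁻ u in Ioo 0 (4 * h), ∫⁻ x, if a ≤ g x ∧ g (x + u) ≤ b then (a - b) ^ p else 0 := by
        refine lintegral_congr fun u => ?_
        have hgu : Measurable fun x => g (x + u) := hg.comp (measurable_id.add_const u)
        have hS : MeasurableSet {x | a ≤ g x ∧ g (x + u) ≤ b} :=
          (measurableSet_le measurable_const hg).inter (measurableSet_le hgu measurable_const)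
        rw [mul_comm, ← lintegral_indicator_const hS]
        simp only [indicator_apply, mem_ofPred_eq]

lemma sq_mul_tsum_gridGap_rpow_le {g : ℝ → ℝ≥0∞} (hg : Measurable g) {h : ℝ} (hh : 0 < h)
    {p : ℝ} (hp : 1 ≤ p) :
    ENNReal.ofReal (h ^ 2) * ∑' i, gridGap g h i ^ p ≤
      ∫⁻ u in Ioo 0 (4 * h), ∫⁻ x, (g x - g (x + u)) ^ p := by
  set a : ℕ → ℝ≥0∞ := fun i => rearrangement g ((i + 1) * h)
  have hm : ∀ i, Measurable fun z : ℝ × ℝ =>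
      if a i ≤ g z.2 ∧ g (z.2 + z.1) ≤ a (i + 1) then gridGap g h i ^ p else 0 := fun i =>
    measurable_level_gap hg _ _ _
  rw [← ENNReal.tsum_mul_left]
  calc _ ≤ ∑' i, ∫⁻ u in Ioo 0 (4 * h), ∫⁻ x,
        (if a i ≤ g x ∧ g (x + u) ≤ a (i + 1) then gridGap g h i ^ p else 0) :=
        ENNReal.tsum_le_tsum fun i => sq_mul_gridGap_rpow_le hg hh (by positivity) i
    _ = ∫⁻ u in Ioo 0 (4 * h), ∫⁻ x,
        ∑' i, (if a i ≤ g x ∧ g (x + u) ≤ a (i + 1) then gridGap g h i ^ p else 0) := by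
        rw [← lintegral_tsum fun i => (hm i).lintegral_prod_right'.aemeasurable]
        exact lintegral_congr fun u => (lintegral_tsum fun i =>
          ((hm i).comp (measurable_prodMk_left (x := u))).aemeasurable).symm
    _ ≤ _ := lintegral_mono fun u => lintegral_mono fun x => by
        simp only [gridGap_eq]
        exact tsum_level_gaps_rpow_le (antitone_rearrangement_grid g hh.le) (g x) (g (x + u)) hp

lemma inv_mul_sum_rpow_le {ι : Type*} (s : Finset ι) (f : ι → ℝ≥0∞) {c M : ℝ≥0∞} (hM₀ : M ≠ 0)
    (hM : M ≠ ∞) (hs : s.card ≤ c * M) {p : ℝ} (hp : 1 ≤ p) :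
    (M⁻¹ * ∑ i ∈ s, f i) ^ p ≤ c ^ (p - 1) * M⁻¹ * ∑ i ∈ s, f i ^ p := by
  have hp1 : 0 ≤ p - 1 := by linarith
  have hMp : M⁻¹ ^ p * M ^ (p - 1) = M⁻¹ := by
    rw [ENNReal.inv_rpow, ← ENNReal.rpow_neg, ← ENNReal.rpow_add _ _ hM₀ hM,
      ← ENNReal.rpow_neg_one]
    ring_nf
  calc (M⁻¹ * ∑ i ∈ s, f i) ^ p = M⁻¹ ^ p * (∑ i ∈ s, f i) ^ p :=
        ENNReal.mul_rpow_of_nonneg _ _ (by positivity)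
    _ ≤ M⁻¹ ^ p * ((c * M) ^ (p - 1) * ∑ i ∈ s, f i ^ p) := by
        gcongr
        exact (ENNReal.rpow_sum_le_const_mul_sum_rpow s f hp).trans (by gcongr)
    _ = c ^ (p - 1) * (M⁻¹ ^ p * M ^ (p - 1)) * ∑ i ∈ s, f i ^ p := by
        rw [ENNReal.mul_rpow_of_nonneg _ _ hp1]; ring
    _ = _ := by rw [hMp]

lemma exists_grid_index {h t : ℝ} (hh : 0 < h) (ht : h ≤ t) :
    ∃ N : ℕ, (N + 1) * h ≤ t ∧ t < (N + 2) * h := by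
  obtain ⟨N, hN⟩ := Nat.exists_eq_succ_of_ne_zero (Nat.floor_pos.2 ((one_le_div hh).2 ht)).ne'
  have hle := Nat.floor_le (div_nonneg (hh.le.trans ht) hh.le)
  have hlt := Nat.lt_floor_add_one (t / h)
  rw [hN, le_div_iff₀ hh] at hle
  rw [hN, div_lt_iff₀ hh] at hlt
  push_cast at hle hlt
  exact ⟨N, hle, by linarith⟩

lemma rearrangement_tsub_two_mul_le_sum_gridGap (g : ℝ → ℝ≥0∞) {h t : ℝ} (hh : 0 ≤ h) {N : ℕ}
    (hle : (N + 1) * h ≤ t) (hlt : t < (N + 2) * h) :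
    rearrangement g t - rearrangement g (2 * t) ≤
      ∑ i ∈ Finset.Ico N (2 * N + 3), gridGap g h i := by
  simp_rw [gridGap_eq]
  rw [sum_Ico_tsub_succ (antitone_rearrangement_grid g hh) (by omega)]
  refine tsub_le_tsub (rearrangement_antitone g hle) (rearrangement_antitone g ?_)
  push_cast
  linarith

lemma inv_natCast_succ_le {N i : ℕ} (hi : i < 2 * N + 3) :
    ((N + 1 : ℕ) : ℝ≥0∞)⁻¹ ≤ 3 * ((i + 1 : ℕ) : ℝ≥0∞)⁻¹ := by
  rw [← div_eq_mul_inv, ENNReal.le_div_iff_mul_le (by simp) (by simp), mul_comm,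
    ← div_eq_mul_inv, ENNReal.div_le_iff_le_mul (by simp) (by simp)]
  exact_mod_cast (by omega : i + 1 ≤ 3 * (N + 1))

lemma weighted_doubling_gap_rpow_le (g : ℝ → ℝ≥0∞) {h t : ℝ} (hh : 0 < h) (ht : h ≤ t) {p : ℝ}
    (hp : 1 ≤ p) :
    (ENNReal.ofReal (h / t) * (rearrangement g t - rearrangement g (2 * t))) ^ p ≤
      ∑' i : ℕ, 3 ^ p * gridGap g h i ^ p *
        ((i + 1 : ℕ) : ℝ≥0∞)⁻¹ * (Ico h ((i + 2) * h)).indicator 1 t := by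
  obtain ⟨N, hle, hlt⟩ := exists_grid_index hh ht
  set M : ℝ≥0∞ := ((N + 1 : ℕ) : ℝ≥0∞) with hM
  have hM₀ : M ≠ 0 := by simp [hM]
  have hweight : ENNReal.ofReal (h / t) ≤ M⁻¹ := by
    rw [hM, ← ENNReal.ofReal_natCast, ← ENNReal.ofReal_inv_of_pos (by positivity)]
    refine ENNReal.ofReal_le_ofReal ?_
    rw [div_le_iff₀ (hh.trans_le ht), inv_mul_eq_div, le_div_iff₀ (by positivity)]
    push_cast
    linarith
  have hcard : ((Finset.Ico N (2 * N + 3)).card : ℝ≥0∞) ≤ 3 * M := by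
    rw [Nat.card_Ico, hM]
    exact_mod_cast (by omega : 2 * N + 3 - N ≤ 3 * (N + 1))
  calc _ ≤ (M⁻¹ * ∑ i ∈ Finset.Ico N (2 * N + 3), gridGap g h i) ^ p := by
        gcongr
        exact rearrangement_tsub_two_mul_le_sum_gridGap g hh.le hle hlt
    _ ≤ 3 ^ (p - 1) * M⁻¹ * ∑ i ∈ Finset.Ico N (2 * N + 3), gridGap g h i ^ p :=
        inv_mul_sum_rpow_le _ _ hM₀ (ENNReal.natCast_ne_top _) hcard hp
    _ ≤ ∑ i ∈ Finset.Ico N (2 * N + 3), 3 ^ p * gridGap g h i ^ p *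
        ((i + 1 : ℕ) : ℝ≥0∞)⁻¹ * (Ico h ((i + 2) * h)).indicator 1 t := by
        rw [Finset.mul_sum]
        refine Finset.sum_le_sum fun i hi => ?_
        obtain ⟨hNi, hiN⟩ := Finset.mem_Ico.1 hi
        have hmem : t ∈ Ico h ((i + 2) * h) := ⟨ht, hlt.trans_le (by gcongr)⟩
        have hthree : (3 : ℝ≥0∞) ^ p = 3 ^ (p - 1) * 3 := by
          conv_lhs => rw [← sub_add_cancel p 1, ENNReal.rpow_add _ _ (by simp) (by simp),
            ENNReal.rpow_one]
        rw [indicator_of_mem hmem, Pi.one_apply, mul_one, hthree]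
        calc _ ≤ 3 ^ (p - 1) * (3 * ((i + 1 : ℕ) : ℝ≥0∞)⁻¹) * gridGap g h i ^ p := by
              gcongr
              exact inv_natCast_succ_le hiN
          _ = _ := by ring
    _ ≤ _ := ENNReal.sum_le_tsum _

theorem lintegral_weighted_doubling_gap_le {g : ℝ → ℝ≥0∞} (hg : Measurable g) {h : ℝ} (hh : 0 < h)
    {p : ℝ} (hp : 1 ≤ p) :
    ∫⁻ t in Ici h,
        (ENNReal.ofReal (h / t) * (rearrangement g t - rearrangement g (2 * t))) ^ p ≤
      3 ^ p * ENNReal.ofReal h⁻¹ * ∫⁻ u in Ioo 0 (4 * h), ∫⁻ x, (g x - g (x + u)) ^ p := by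
  have hcell : ∀ i : ℕ, ((i + 1 : ℕ) : ℝ≥0∞)⁻¹ * volume (Ico h ((i + 2) * h)) =
      ENNReal.ofReal h := fun i => by
    have hlen : ((i : ℝ) + 2) * h - h = ((i + 1 : ℕ) : ℝ) * h := by push_cast; ring
    rw [Real.volume_Ico, hlen, ENNReal.ofReal_mul (Nat.cast_nonneg _), ENNReal.ofReal_natCast,
      ENNReal.inv_mul_cancel_left (by simp) (ENNReal.natCast_ne_top _)]
  have hh_split : ENNReal.ofReal h = ENNReal.ofReal h⁻¹ * ENNReal.ofReal (h ^ 2) := by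
    rw [← ENNReal.ofReal_mul (by positivity)]
    congr 1
    field_simp
  calc _ ≤ ∫⁻ t in Ici h, ∑' i : ℕ, 3 ^ p * gridGap g h i ^ p *
        ((i + 1 : ℕ) : ℝ≥0∞)⁻¹ * (Ico h ((i + 2) * h)).indicator 1 t :=
        setLIntegral_mono' measurableSet_Ici fun t ht => weighted_doubling_gap_rpow_le g hh ht hp
    _ ≤ ∫⁻ t, ∑' i : ℕ, 3 ^ p * gridGap g h i ^ p *
        ((i + 1 : ℕ) : ℝ≥0∞)⁻¹ * (Ico h ((i + 2) * h)).indicator 1 t :=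
        setLIntegral_le_lintegral _ _
    _ = ∑' i, 3 ^ p * gridGap g h i ^ p * ENNReal.ofReal h := by
        have hind : ∀ i : ℕ, Measurable ((Ico h ((i + 2) * h)).indicator (1 : ℝ → ℝ≥0∞)) :=
          fun i => measurable_one.indicator measurableSet_Ico
        rw [lintegral_tsum fun i => ((hind i).const_mul _).aemeasurable]
        refine tsum_congr fun i => ?_
        rw [lintegral_const_mul _ (hind i), lintegral_indicator_one measurableSet_Ico, mul_assoc,
          hcell]
    _ = 3 ^ p * ENNReal.ofReal h⁻¹ * (ENNReal.ofReal (h ^ 2) * ∑' i, gridGap g h i ^ p) := by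
        rw [ENNReal.tsum_mul_right, ENNReal.tsum_mul_left, hh_split]
        ring
    _ ≤ _ := by
        gcongr
        exact sq_mul_tsum_gridGap_rpow_le hg hh hp

end Translates

section PartialRearrangement

open Function (update)

variable {n : ℕ} {j k : Fin n} {l : List (Fin n)} {g h : (Fin n → ℝ) → ℝ≥0∞}

lemma lintegral_le_of_fibre_le (k : Fin n) (hg : Measurable g) (hh : Measurable h)
    (hgh : ∀ x, ∫⁻ s, g (update x k s) ≤ ∫⁻ s, h (update x k s)) :
    ∫⁻ x, g x ≤ ∫⁻ x, h x := by
  refine lintegral_le_of_lmarginal_le (μ := fun _ : Fin n => (volume : Measure ℝ)) {k} hg hh ?_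
  intro x
  simpa only [lmarginal_singleton] using hgh x

lemma measurable_partialRearrangement (k : Fin n) (hg : Measurable g) :
    Measurable (partialRearrangement k g) := by
  have hpos : MeasurableSet {x : Fin n → ℝ | 0 < x k} :=
    measurableSet_lt measurable_const (measurable_pi_apply k)
  refine Measurable.ite hpos (measurable_of_Iio fun a => ?_) measurable_const
  have hset : (fun x => rearrangement (fun s => g (update x k s)) (x k)) ⁻¹' Iio a =
      ⋃ r : ℚ, {x | (Real.toNNReal r : ℝ≥0∞) < a ∧
        distribution (fun s => g (update x k s)) (Real.toNNReal r) < ENNReal.ofReal (x k)} := by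
    ext x
    simp only [mem_preimage, mem_Iio, mem_iUnion, mem_ofPred_eq]
    refine ⟨fun hx => ?_, fun ⟨r, hra, hr⟩ => lt_of_le_of_lt (sInf_le hr) hra⟩
    obtain ⟨y, hy, hya⟩ := sInf_lt_iff.1 hx
    obtain ⟨r, -, hyr, hra⟩ := ENNReal.lt_iff_exists_rat_btwn.1 hya
    exact ⟨r, hra, (distribution_antitone _ hyr.le).trans_lt hy⟩
  rw [hset]
  refine MeasurableSet.iUnion fun r => (MeasurableSet.const _).inter (measurableSet_lt ?_
    (ENNReal.measurable_ofReal.comp (measurable_pi_apply k)))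
  have hsuper : MeasurableSet {z : (Fin n → ℝ) × ℝ |
      (Real.toNNReal r : ℝ≥0∞) < g (update z.1 k z.2)} :=
    measurableSet_lt measurable_const (hg.comp measurable_update')
  exact measurable_measure_prodMk_left hsuper

lemma ae_volume_fibre_eq_zero (k : Fin n) {M : Set (Fin n → ℝ)} (hM : volume M = 0) :
    ∀ᵐ x, volume {s | update x k s ∈ M} = 0 := by
  obtain ⟨N, hMN, hN, hN0⟩ := exists_measurable_superset_of_null hM
  set m : (Fin n → ℝ) → ℝ≥0∞ := fun x => volume {s | update x k s ∈ N} with hm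
  have hm_meas : Measurable m := measurable_measure_prodMk_left (measurable_update' hN)
  have hfibre : ∀ x, ∫⁻ s, N.indicator 1 (update x k s) = m x := fun x =>
    lintegral_indicator_one (measurable_update x hN)
  have hbad : MeasurableSet {x | m x ≠ 0} := (hm_meas (measurableSet_singleton 0)).compl
  have hle : ∫⁻ x, {x | m x ≠ 0}.indicator 1 x ≤ ∫⁻ x, ∞ * N.indicator 1 x := by
    refine lintegral_le_of_fibre_le k (measurable_one.indicator hbad)
      ((measurable_one.indicator hN).const_mul _) fun x => ?_
    have hind : Measurable fun s => N.indicator (1 : (Fin n → ℝ) → ℝ≥0∞) (update x k s) :=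
      (measurable_one.indicator hN).comp (measurable_update x)
    rw [lintegral_const_mul _ hind, hfibre]
    by_cases hx : m x = 0
    · have : ∀ s, m (update x k s) = 0 := fun s => by simpa [hm] using hx
      simp [this, hx]
    · rw [ENNReal.top_mul hx]
      exact le_top
  rw [lintegral_indicator_one hbad, lintegral_const_mul _ (measurable_one.indicator hN),
    lintegral_indicator_one hN, hN0, mul_zero] at hle
  exact (measure_eq_zero_iff_ae_notMem.1 (le_antisymm hle bot_le)).mono fun x hx =>
    measure_mono_null (fun s hs => hMN hs) (not_not.1 hx)

lemma partialRearrangement_congr_ae (k : Fin n) (hgh : g =ᵐ[volume] h) :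
    partialRearrangement k g =ᵐ[volume] partialRearrangement k h :=
  (ae_volume_fibre_eq_zero k (ae_iff.1 hgh)).mono fun x hx => by
    have hae : (fun s => g (update x k s)) =ᵐ[volume] fun s => h (update x k s) := hx
    simp only [partialRearrangement, rearrangement_congr_ae hae]

/-- Apply `ψ` to the `k`-th coordinate; used for dilations and translations in one variable. -/
def coordMap (k : Fin n) (ψ : ℝ → ℝ) (x : Fin n → ℝ) : Fin n → ℝ := update x k (ψ (x k))

lemma measurable_coordMap (k : Fin n) {ψ : ℝ → ℝ} (hψ : Measurable ψ) :
    Measurable (coordMap k ψ) :=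
  measurable_update'.comp (measurable_id.prodMk (hψ.comp (measurable_pi_apply k)))

lemma coordMap_update (k : Fin n) (ψ : ℝ → ℝ) (x : Fin n → ℝ) (s : ℝ) :
    coordMap k ψ (update x k s) = update x k (ψ s) := by
  simp [coordMap]

lemma coordMap_update_of_ne (hjk : j ≠ k) (ψ : ℝ → ℝ) (x : Fin n → ℝ) (s : ℝ) :
    coordMap k ψ (update x j s) = update (coordMap k ψ x) j s := by
  simp only [coordMap, Function.update_of_ne hjk.symm]
  exact Function.update_comm hjk _ _ _

lemma partialRearrangement_comp_coordMap (hjk : j ≠ k) (ψ : ℝ → ℝ) (g : (Fin n → ℝ) → ℝ≥0∞) :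
    partialRearrangement j (g ∘ coordMap k ψ) = partialRearrangement j g ∘ coordMap k ψ := by
  funext x
  have hj : coordMap k ψ x j = x j := by simp [coordMap, hjk]
  simp only [partialRearrangement, Function.comp, hj, coordMap_update_of_ne hjk]

lemma partialRearrangement_zero (k : Fin n) :
    partialRearrangement k (fun _ => 0) = fun _ => 0 := by
  funext x
  simp only [partialRearrangement]
  split_ifs with hx
  exacts [rearrangement_zero hx, rfl]

lemma lintegral_partialRearrangement_tsub_rpow_le (j : Fin n) {W : (Fin n → ℝ) → ℝ≥0∞}
    (hg : Measurable g) (hh : Measurable h) (hW : Measurable W)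
    (hWj : ∀ x s, W (update x j s) = W x) {p : ℝ} (hp : 1 ≤ p) :
    ∫⁻ x, W x * (partialRearrangement j g x - partialRearrangement j h x) ^ p ≤
      ∫⁻ x, W x * (g x - h x) ^ p := by
  have hp0 : 0 < p := by positivity
  have hgh : Measurable fun x => (g x - h x) ^ p := (hg.sub hh).pow_const p
  have hRgh : Measurable fun x =>
      (partialRearrangement j g x - partialRearrangement j h x) ^ p :=
    ((measurable_partialRearrangement j hg).sub
      (measurable_partialRearrangement j hh)).pow_const p
  refine lintegral_le_of_fibre_le j (hW.mul hRgh) (hW.mul hgh) fun x => ?_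
  have hx : Measurable (update x j) := measurable_update x
  simp_rw [hWj]
  refine ((lintegral_const_mul _ (hRgh.comp hx)).trans_le ?_).trans_eq
    (lintegral_const_mul _ (hgh.comp hx)).symm
  refine mul_le_mul' le_rfl (le_of_eq_of_le ?_
    (lintegral_rearrangement_tsub_rpow_le (hg.comp hx) (hh.comp hx) hp))
  rw [← lintegral_indicator measurableSet_Ioi]
  refine lintegral_congr fun s => ?_
  by_cases hs : 0 < s
  · simp [partialRearrangement, hs, Function.comp_def]
  · simp [partialRearrangement, hs, hp0]

/-- Successive partial rearrangement along a list of coordinates, first entry first. The iterated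
rearrangement is the case of an enumeration of all coordinates. -/
noncomputable def listRearrangement (l : List (Fin n)) (g : (Fin n → ℝ) → ℝ≥0∞) :
    (Fin n → ℝ) → ℝ≥0∞ :=
  l.foldl (fun g k => partialRearrangement k g) g

lemma listRearrangement_cons (k : Fin n) (l : List (Fin n)) (g : (Fin n → ℝ) → ℝ≥0∞) :
    listRearrangement (k :: l) g = listRearrangement l (partialRearrangement k g) := rfl

lemma measurable_listRearrangement (l : List (Fin n)) (hg : Measurable g) :
    Measurable (listRearrangement l g) := by
  induction l generalizing g with
  | nil => exact hg
  | cons k _ ih => exact ih (measurable_partialRearrangement k hg)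

lemma listRearrangement_congr_ae (l : List (Fin n)) (hgh : g =ᵐ[volume] h) :
    listRearrangement l g =ᵐ[volume] listRearrangement l h := by
  induction l generalizing g h with
  | nil => exact hgh
  | cons k _ ih => exact ih (partialRearrangement_congr_ae k hgh)

lemma listRearrangement_zero (l : List (Fin n)) :
    listRearrangement l (fun _ => 0) = fun _ => 0 := by
  induction l with
  | nil => rfl
  | cons k l ih => rw [listRearrangement_cons, partialRearrangement_zero, ih]

lemma listRearrangement_comp_coordMap (hk : k ∉ l) (ψ : ℝ → ℝ) (g : (Fin n → ℝ) → ℝ≥0∞) :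
    listRearrangement l (g ∘ coordMap k ψ) = listRearrangement l g ∘ coordMap k ψ := by
  induction l generalizing g with
  | nil => rfl
  | cons j l ih =>
    rw [List.mem_cons, not_or] at hk
    rw [listRearrangement_cons, listRearrangement_cons,
      partialRearrangement_comp_coordMap (Ne.symm hk.1), ih hk.2]

lemma lintegral_listRearrangement_tsub_rpow_le (l : List (Fin n)) {W : (Fin n → ℝ) → ℝ≥0∞}
    (hg : Measurable g) (hh : Measurable h) (hW : Measurable W)
    (hWl : ∀ j ∈ l, ∀ x s, W (update x j s) = W x) {p : ℝ} (hp : 1 ≤ p) :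
    ∫⁻ x, W x * (listRearrangement l g x - listRearrangement l h x) ^ p ≤
      ∫⁻ x, W x * (g x - h x) ^ p := by
  induction l generalizing g h with
  | nil => exact le_rfl
  | cons j l ih =>
    exact (ih (measurable_partialRearrangement j hg) (measurable_partialRearrangement j hh)
      fun i hi => hWl i (List.mem_cons_of_mem _ hi)).trans
      (lintegral_partialRearrangement_tsub_rpow_le j hg hh hW (hWl j List.mem_cons_self) hp)

/-- `g` is nonincreasing in the `k`-th variable on the half-space `x k > 0`. -/
def AntitoneCoord (k : Fin n) (g : (Fin n → ℝ) → ℝ≥0∞) : Prop :=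
  ∀ x s t, 0 < s → s ≤ t → g (update x k t) ≤ g (update x k s)

lemma antitoneCoord_partialRearrangement_self (k : Fin n) (g : (Fin n → ℝ) → ℝ≥0∞) :
    AntitoneCoord k (partialRearrangement k g) := by
  intro x s t hs hst
  simp only [partialRearrangement, Function.update_self, hs, hs.trans_le hst, if_true,
    Function.update_idem]
  exact rearrangement_antitone _ hst

lemma AntitoneCoord.partialRearrangement (hg : AntitoneCoord k g) (j : Fin n) :
    AntitoneCoord k (partialRearrangement j g) := by
  rcases eq_or_ne j k with rfl | hjk
  · exact antitoneCoord_partialRearrangement_self _ _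
  intro x s t hs hst
  simp only [AnisoBesov.partialRearrangement, Function.update_of_ne hjk]
  split_ifs
  · refine rearrangement_mono (fun r => ?_) _
    rw [Function.update_comm hjk.symm, Function.update_comm hjk.symm]
    exact hg _ s t hs hst
  · exact le_rfl

lemma AntitoneCoord.listRearrangement (hg : AntitoneCoord k g) (l : List (Fin n)) :
    AntitoneCoord k (listRearrangement l g) := by
  induction l generalizing g with
  | nil => exact hg
  | cons j _ ih => exact ih (hg.partialRearrangement j)

lemma antitoneCoord_listRearrangement (hk : k ∈ l) (g : (Fin n → ℝ) → ℝ≥0∞) :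
    AntitoneCoord k (listRearrangement l g) := by
  induction l generalizing g with
  | nil => simp at hk
  | cons j l ih =>
    rcases eq_or_ne k j with rfl | hkj
    · exact (antitoneCoord_partialRearrangement_self k g).listRearrangement l
    · exact ih (List.mem_of_ne_of_mem hkj hk) _

lemma le_of_forall_antitoneCoord (hg : ∀ k, AntitoneCoord k g) {s t : Fin n → ℝ}
    (hs : ∀ i, 0 < s i) (hst : s ≤ t) : g t ≤ g s := by
  suffices ∀ A : Finset (Fin n), g t ≤ g (A.piecewise s t) by simpa using this Finset.univ
  intro A
  induction A using Finset.induction_on with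
  | empty => simp
  | insert k A hk ih =>
    have hupdate : update (A.piecewise s t) k (t k) = A.piecewise s t := by simp [hk]
    have hstep := hg k (A.piecewise s t) (s k) (t k) (hs k) (hst k)
    rw [hupdate, ← Finset.piecewise_insert] at hstep
    exact ih.trans hstep

end PartialRearrangement

section DoublingDifference

open Function (update)

/-- The weight `t ↦ (δ / t) 1_{t ≥ δ}`. -/
noncomputable def tailWeight (δ t : ℝ) : ℝ≥0∞ :=
  (Ici δ).indicator (fun t => ENNReal.ofReal (δ / t)) t

lemma measurable_tailWeight (δ : ℝ) : Measurable (tailWeight δ) :=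
  Measurable.indicator (by fun_prop) measurableSet_Ici

lemma tailWeight_of_le {δ t : ℝ} (ht : δ ≤ t) : tailWeight δ t = ENNReal.ofReal (δ / t) :=
  indicator_of_mem (s := Ici δ) ht _

lemma tailWeight_of_lt {δ t : ℝ} (ht : t < δ) : tailWeight δ t = 0 :=
  indicator_of_notMem (s := Ici δ) (not_le.2 ht) _

lemma tailWeight_le_four_mul {δ : ℝ} (hδ : 0 ≤ δ) (t : ℝ) :
    tailWeight δ t ≤ 4 * tailWeight (δ / 4) t := by
  rcases lt_or_ge t δ with ht | ht
  · simp [tailWeight_of_lt ht]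
  rw [tailWeight_of_le ht, tailWeight_of_le (by linarith), ← ENNReal.ofReal_ofNat,
    ← ENNReal.ofReal_mul (by norm_num)]
  refine (congrArg ENNReal.ofReal ?_).le
  ring

lemma lintegral_tailWeight_mul_rpow (δ : ℝ) (F : ℝ → ℝ≥0∞) {p : ℝ} (hp : 0 < p) :
    ∫⁻ t, (tailWeight δ t * F t) ^ p = ∫⁻ t in Ici δ, (ENNReal.ofReal (δ / t) * F t) ^ p := by
  rw [← lintegral_indicator measurableSet_Ici]
  refine lintegral_congr fun t => ?_
  by_cases ht : t ∈ Ici δ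
  · rw [indicator_of_mem ht, tailWeight_of_le ht]
  · rw [indicator_of_notMem ht, tailWeight_of_lt (not_le.1 ht), zero_mul,
      ENNReal.zero_rpow_of_pos hp]

lemma lintegral_tailWeight_rearrangement_le {g : ℝ → ℝ≥0∞} (hg : Measurable g) {δ : ℝ}
    (hδ : 0 < δ) {p : ℝ} (hp : 1 ≤ p) :
    ∫⁻ t, (tailWeight δ t * (rearrangement g t - rearrangement g (2 * t))) ^ p ≤
      4 * 12 ^ p * ENNReal.ofReal δ⁻¹ * ∫⁻ u in Ioo 0 δ, ∫⁻ x, (g x - g (x + u)) ^ p := by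
  have hp0 : 0 < p := by positivity
  have hquarter := lintegral_weighted_doubling_gap_le hg (h := δ / 4) (by positivity) hp
  rw [mul_div_cancel₀ δ (by norm_num)] at hquarter
  have hconst : (4 : ℝ≥0∞) ^ p * (3 ^ p * ENNReal.ofReal (δ / 4)⁻¹) =
      4 * 12 ^ p * ENNReal.ofReal δ⁻¹ := by
    have htwelve : (12 : ℝ≥0∞) ^ p = 4 ^ p * 3 ^ p := by
      rw [← ENNReal.mul_rpow_of_nonneg _ _ hp0.le]
      norm_num
    rw [inv_div, div_eq_mul_inv, ENNReal.ofReal_mul (by norm_num), ENNReal.ofReal_ofNat, htwelve]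
    ring
  have hmeas : Measurable fun t =>
      (tailWeight (δ / 4) t * (rearrangement g t - rearrangement g (2 * t))) ^ p := by
    have := measurable_tailWeight (δ / 4)
    have := measurable_rearrangement g
    fun_prop
  calc _ ≤ ∫⁻ t, 4 ^ p *
        (tailWeight (δ / 4) t * (rearrangement g t - rearrangement g (2 * t))) ^ p := by
        refine lintegral_mono fun t => ?_
        rw [← ENNReal.mul_rpow_of_nonneg _ _ hp0.le, ← mul_assoc]
        gcongr
        exact tailWeight_le_four_mul hδ.le t
    _ ≤ 4 ^ p * (3 ^ p * ENNReal.ofReal (δ / 4)⁻¹ *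
        ∫⁻ u in Ioo 0 δ, ∫⁻ x, (g x - g (x + u)) ^ p) := by
        rw [lintegral_const_mul _ hmeas, lintegral_tailWeight_mul_rpow _ _ hp0]
        gcongr
    _ = _ := by rw [← hconst]; ring

variable {n : ℕ}

lemma measurable_coordMap_add (k : Fin n) :
    Measurable fun z : (Fin n → ℝ) × ℝ => coordMap k (· + z.2) z.1 :=
  measurable_update'.comp (measurable_fst.prodMk
    (((measurable_pi_apply k).comp measurable_fst).add measurable_snd))

lemma lintegral_tailWeight_partialRearrangement_le (k : Fin n) {G : (Fin n → ℝ) → ℝ≥0∞}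
    (hG : Measurable G) {δ : ℝ} (hδ : 0 < δ) {p : ℝ} (hp : 1 ≤ p) :
    ∫⁻ x, (tailWeight δ (x k) * (partialRearrangement k G x -
        partialRearrangement k G (coordMap k (2 * ·) x))) ^ p ≤
      4 * 12 ^ p * ENNReal.ofReal δ⁻¹ *
        ∫⁻ u in Ioo 0 δ, ∫⁻ x, (G x - G (coordMap k (· + u) x)) ^ p := by
  have hp0 : 0 < p := by positivity
  have hR := measurable_partialRearrangement k hG
  have hdil : Measurable (coordMap k (2 * ·)) := measurable_coordMap k (by fun_prop)
  have hdiff : Measurable fun z : (Fin n → ℝ) × ℝ =>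
      (G z.1 - G (coordMap k (· + z.2) z.1)) ^ p :=
    ((hG.comp measurable_fst).sub (hG.comp (measurable_coordMap_add k))).pow_const p
  rw [lintegral_lintegral_swap (by exact (hdiff.comp measurable_swap).aemeasurable),
    ← lintegral_const_mul _ hdiff.lintegral_prod_right']
  refine lintegral_le_of_fibre_le k
    (((measurable_tailWeight δ).comp (measurable_pi_apply k)).mul
      (hR.sub (hR.comp hdil)) |>.pow_const p) (hdiff.lintegral_prod_right'.const_mul _) fun x => ?_
  have hfibre : Measurable fun s => G (update x k s) := hG.comp (measurable_update x)
  refine (le_of_eq ?_).trans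
    ((lintegral_tailWeight_rearrangement_le hfibre hδ hp).trans_eq ?_)
  · refine lintegral_congr fun t => ?_
    rcases lt_or_ge t δ with ht | ht
    · simp [tailWeight_of_lt ht, hp0]
    · simp [coordMap_update, partialRearrangement, hδ.trans_le ht]
  · rw [lintegral_const_mul _ (by exact hdiff.lintegral_prod_right'.comp (measurable_update x)),
      lintegral_lintegral_swap (((hfibre.comp measurable_snd).sub
        (hfibre.comp (measurable_snd.add measurable_fst))).pow_const p).aemeasurable]
    simp only [coordMap_update]

lemma coordMap_add_eq (k : Fin n) (u : ℝ) (x : Fin n → ℝ) :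
    coordMap k (· + u) x = x + Pi.single k u := by
  funext i
  rcases eq_or_ne i k with rfl | hi
  · simp [coordMap]
  · simp [coordMap, hi]

lemma lintegral_enorm_tsub_translate_le (f : (Fin n → ℝ) → ℝ) (k : Fin n) {p : ℝ} (hp : 0 < p)
    {δ u : ℝ} (hu : |u| ≤ δ) :
    ∫⁻ x, (‖f x‖ₑ - ‖f (coordMap k (· + u) x)‖ₑ) ^ p ≤ partialModulus p k f δ ^ p := by
  have hmod : eLpNorm (fun x => f (x + Pi.single k u) - f x) (ENNReal.ofReal p) volume ≤
      partialModulus p k f δ := le_iSup₂_of_le u hu le_rfl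
  refine le_trans ?_ (ENNReal.rpow_le_rpow hmod hp.le)
  rw [eLpNorm_eq_lintegral_rpow_enorm_toReal (ENNReal.ofReal_pos.2 hp).ne' ENNReal.ofReal_ne_top,
    ENNReal.toReal_ofReal hp.le, ← ENNReal.rpow_mul, one_div_mul_cancel hp.ne', ENNReal.rpow_one]
  refine lintegral_mono fun x => ENNReal.rpow_le_rpow ?_ hp.le
  have htri := enorm_sub_le (a := f (x + Pi.single k u)) (b := f (x + Pi.single k u) - f x)
  rw [sub_sub_cancel] at htri
  rwa [coordMap_add_eq, tsub_le_iff_left]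

lemma exists_iteratedRearrangement_eq (σ : Equiv.Perm (Fin n)) (k : Fin n) :
    ∃ l₁ l₂ : List (Fin n), k ∉ l₁ ∧ k ∉ l₂ ∧ ∀ f : (Fin n → ℝ) → ℝ,
      iteratedRearrangement σ f =
        listRearrangement l₂ (partialRearrangement k (listRearrangement l₁ fun x => ‖f x‖ₑ)) := by
  obtain ⟨l₁, l₂, hl⟩ := List.append_of_mem (List.mem_ofFn.2 (σ.surjective k))
  have hnodup : (l₁ ++ k :: l₂).Nodup := hl ▸ List.nodup_ofFn.2 σ.injective
  rw [List.nodup_middle, List.nodup_cons, List.mem_append, not_or] at hnodup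
  refine ⟨l₁, l₂, hnodup.1.1, hnodup.1.2, fun f => ?_⟩
  rw [iteratedRearrangement, hl, List.foldl_append]
  rfl

lemma lintegral_listRearrangement_enorm_tsub_translate_le {f : (Fin n → ℝ) → ℝ}
    (hf : Measurable f) {k : Fin n} {l : List (Fin n)} (hk : k ∉ l) {p : ℝ} (hp : 1 ≤ p)
    {δ u : ℝ} (hu : |u| ≤ δ) :
    ∫⁻ x, (listRearrangement l (fun x => ‖f x‖ₑ) x -
        listRearrangement l (fun x => ‖f x‖ₑ) (coordMap k (· + u) x)) ^ p ≤
      partialModulus p k f δ ^ p := by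
  have hcontr := lintegral_listRearrangement_tsub_rpow_le l hf.enorm
    (hf.enorm.comp (measurable_coordMap k (measurable_add_const u))) (W := fun _ => 1)
    measurable_const (fun _ _ _ _ => rfl) hp
  rw [listRearrangement_comp_coordMap hk] at hcontr
  simp only [one_mul] at hcontr
  exact hcontr.trans (lintegral_enorm_tsub_translate_le f k (by positivity) hu)

lemma lintegral_tailWeight_listRearrangement_le {l : List (Fin n)} {k : Fin n} (hk : k ∉ l)
    {g : (Fin n → ℝ) → ℝ≥0∞} (hg : Measurable g) (δ : ℝ) {p : ℝ} (hp : 1 ≤ p) :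
    ∫⁻ x, (tailWeight δ (x k) *
        (listRearrangement l g x - listRearrangement l g (coordMap k (2 * ·) x))) ^ p ≤
      ∫⁻ x, (tailWeight δ (x k) * (g x - g (coordMap k (2 * ·) x))) ^ p := by
  have hW : Measurable fun x : Fin n → ℝ => tailWeight δ (x k) ^ p :=
    ((measurable_tailWeight δ).comp (measurable_pi_apply k)).pow_const p
  have hWl : ∀ j ∈ l, ∀ (x : Fin n → ℝ) s,
      tailWeight δ (update x j s k) ^ p = tailWeight δ (x k) ^ p := fun j hj x s => by
    rw [Function.update_of_ne (ne_of_mem_of_not_mem hj hk).symm]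
  have hcontr := lintegral_listRearrangement_tsub_rpow_le l hg
    (hg.comp (measurable_coordMap k (measurable_const_mul 2))) hW hWl hp
  rw [listRearrangement_comp_coordMap hk] at hcontr
  simpa only [ENNReal.mul_rpow_of_nonneg _ _ (zero_le_one.trans hp), Function.comp_apply]
    using hcontr

theorem lintegral_tailWeight_iteratedRearrangement_le {f : (Fin n → ℝ) → ℝ} (hf : Measurable f)
    (σ : Equiv.Perm (Fin n)) (k : Fin n) {δ : ℝ} (hδ : 0 < δ) {p : ℝ} (hp : 1 ≤ p) :
    ∫⁻ x, (tailWeight δ (x k) * (iteratedRearrangement σ f x -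
        iteratedRearrangement σ f (coordMap k (2 * ·) x))) ^ p ≤
      4 * 12 ^ p * partialModulus p k f δ ^ p := by
  obtain ⟨l₁, l₂, hk₁, hk₂, hσ⟩ := exists_iteratedRearrangement_eq σ k
  have hG : Measurable (listRearrangement l₁ fun x => ‖f x‖ₑ) :=
    measurable_listRearrangement _ hf.enorm
  rw [hσ f]
  refine (lintegral_tailWeight_listRearrangement_le hk₂
    (measurable_partialRearrangement k hG) δ hp).trans
    ((lintegral_tailWeight_partialRearrangement_le k hG hδ hp).trans ?_)
  have hcancel : ENNReal.ofReal δ⁻¹ * ENNReal.ofReal δ = 1 := by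
    rw [← ENNReal.ofReal_mul (by positivity), inv_mul_cancel₀ hδ.ne', ENNReal.ofReal_one]
  calc _ ≤ 4 * 12 ^ p * ENNReal.ofReal δ⁻¹ * ∫⁻ _ in Ioo 0 δ, partialModulus p k f δ ^ p :=
        mul_le_mul' le_rfl (setLIntegral_mono' measurableSet_Ioo fun u hu =>
          lintegral_listRearrangement_enorm_tsub_translate_le hf hk₁ hp
            (abs_le.2 ⟨by linarith [hu.1], hu.2.le⟩))
    _ = 4 * 12 ^ p * partialModulus p k f δ ^ p * (ENNReal.ofReal δ⁻¹ * ENNReal.ofReal δ) := by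
        rw [setLIntegral_const, Real.volume_Ioo, sub_zero]
        ring
    _ = _ := by rw [hcancel, mul_one]

lemma measurable_iteratedRearrangement {f : (Fin n → ℝ) → ℝ} (hf : Measurable f)
    (σ : Equiv.Perm (Fin n)) : Measurable (iteratedRearrangement σ f) :=
  measurable_listRearrangement _ hf.enorm

lemma iteratedRearrangement_congr_ae {f g : (Fin n → ℝ) → ℝ} (hfg : f =ᵐ[volume] g)
    (σ : Equiv.Perm (Fin n)) :
    iteratedRearrangement σ f =ᵐ[volume] iteratedRearrangement σ g :=
  listRearrangement_congr_ae _ (hfg.fun_comp fun y => ‖y‖ₑ)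

lemma iteratedRearrangement_antitone (σ : Equiv.Perm (Fin n)) (f : (Fin n → ℝ) → ℝ)
    {s t : Fin n → ℝ} (hs : ∀ i, 0 < s i) (hst : s ≤ t) :
    iteratedRearrangement σ f t ≤ iteratedRearrangement σ f s :=
  le_of_forall_antitoneCoord
    (fun k => antitoneCoord_listRearrangement (List.mem_ofFn.2 (σ.surjective k)) _) hs hst

lemma lintegral_iteratedRearrangement_rpow_le {f : (Fin n → ℝ) → ℝ} (hf : Measurable f)
    (σ : Equiv.Perm (Fin n)) {p : ℝ} (hp : 1 ≤ p) :
    ∫⁻ x, iteratedRearrangement σ f x ^ p ≤ ∫⁻ x, ‖f x‖ₑ ^ p := by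
  have hcontr := lintegral_listRearrangement_tsub_rpow_le (List.ofFn σ) hf.enorm
    (measurable_const (a := (0 : ℝ≥0∞))) (W := fun _ => 1) measurable_const
    (fun _ _ _ _ => rfl) hp
  rw [listRearrangement_zero] at hcontr
  simp only [one_mul, tsub_zero] at hcontr
  exact hcontr

end DoublingDifference

section Lattice

variable {n : ℕ} {ε : ℝ}

/-- The exponential weight `2^{-ε |ξ|₁}` on `ℤ^n`. -/
noncomputable def latticeWeight (ε : ℝ) (ξ : Fin n → ℤ) : ℝ≥0∞ :=
  ∏ i, (2 : ℝ≥0∞) ^ (-(ε * |(ξ i : ℝ)|))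

/-- The least majorant of `z` whose logarithm in base `2` is `ε`-Lipschitz for the `ℓ¹` metric. -/
noncomputable def slowMajorant (ε : ℝ) (z : (Fin n → ℤ) → ℝ≥0∞) (ν : Fin n → ℤ) : ℝ≥0∞ :=
  ⨆ μ, latticeWeight ε (ν - μ) * z μ

lemma latticeWeight_le_one (hε : 0 ≤ ε) (ξ : Fin n → ℤ) : latticeWeight ε ξ ≤ 1 :=
  Finset.prod_le_one' fun _ _ => (ENNReal.rpow_le_rpow_of_exponent_le one_le_two
    (neg_nonpos.2 (mul_nonneg hε (abs_nonneg _)))).trans_eq ENNReal.rpow_zero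

lemma le_slowMajorant (ε : ℝ) (z : (Fin n → ℤ) → ℝ≥0∞) (ν : Fin n → ℤ) :
    z ν ≤ slowMajorant ε z ν :=
  le_iSup_of_le ν (by simp [latticeWeight])

lemma latticeWeight_add_single_le (hε : 0 ≤ ε) (ξ : Fin n → ℤ) (k : Fin n) :
    latticeWeight ε (ξ + Pi.single k 1) ≤ 2 ^ ε * latticeWeight ε ξ := by
  simp only [latticeWeight]
  rw [← Finset.mul_prod_erase _ _ (Finset.mem_univ k), ← Finset.mul_prod_erase _ _
    (Finset.mem_univ k), ← mul_assoc]
  refine mul_le_mul' ?_ (le_of_eq (Finset.prod_congr rfl fun i hi => ?_))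
  · have habs : |(ξ k : ℝ)| ≤ |(ξ k : ℝ) + 1| + 1 := by
      simpa using abs_sub ((ξ k : ℝ) + 1) 1
    rw [← ENNReal.rpow_add _ _ (by norm_num) (by norm_num)]
    refine ENNReal.rpow_le_rpow_of_exponent_le (by norm_num) ?_
    simp only [Pi.add_apply, Pi.single_eq_same, Int.cast_add, Int.cast_one]
    nlinarith
  · simp [Finset.ne_of_mem_erase hi]

lemma slowMajorant_add_single_le (hε : 0 ≤ ε) (z : (Fin n → ℤ) → ℝ≥0∞) (ν : Fin n → ℤ)
    (k : Fin n) : slowMajorant ε z (ν + Pi.single k 1) ≤ 2 ^ ε * slowMajorant ε z ν := by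
  refine iSup_le fun μ => ?_
  calc _ ≤ 2 ^ ε * latticeWeight ε (ν - μ) * z μ := by
        gcongr
        rw [add_sub_right_comm]
        exact latticeWeight_add_single_le hε _ _
    _ = 2 ^ ε * (latticeWeight ε (ν - μ) * z μ) := mul_assoc _ _ _
    _ ≤ _ := by
        gcongr
        exact le_iSup (fun μ => latticeWeight ε (ν - μ) * z μ) μ

lemma slowMajorant_le_of_le (hε : 0 ≤ ε) {z : (Fin n → ℤ) → ℝ≥0∞} {S : ℝ≥0∞}
    (hz : ∀ ν, z ν ≤ S) (ν : Fin n → ℤ) : slowMajorant ε z ν ≤ S :=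
  iSup_le fun μ => (mul_le_mul' (latticeWeight_le_one hε _) (hz μ)).trans_eq (one_mul S)

lemma tsum_slowMajorant_rpow_le (hε : 0 ≤ ε) (z : (Fin n → ℤ) → ℝ≥0∞) {θ : ℝ} (hθ : 1 ≤ θ) :
    ∑' ν, slowMajorant ε z ν ^ θ ≤ (∑' ξ : Fin n → ℤ, latticeWeight ε ξ) * ∑' ν, z ν ^ θ := by
  have hθ0 : 0 < θ := by positivity
  have hpointwise : ∀ ν, slowMajorant ε z ν ^ θ ≤ ∑' μ, latticeWeight ε (ν - μ) * z μ ^ θ := by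
    intro ν
    rw [← ENNReal.le_rpow_inv_iff hθ0]
    refine iSup_le fun μ => ?_
    rw [ENNReal.le_rpow_inv_iff hθ0, ENNReal.mul_rpow_of_nonneg _ _ hθ0.le]
    refine le_trans ?_ (ENNReal.le_tsum μ)
    gcongr
    exact ENNReal.rpow_le_self_of_le_one (latticeWeight_le_one hε _) hθ
  calc _ ≤ ∑' ν, ∑' μ, latticeWeight ε (ν - μ) * z μ ^ θ := ENNReal.tsum_le_tsum hpointwise
    _ = ∑' μ, ∑' ν, latticeWeight ε (ν - μ) * z μ ^ θ := ENNReal.tsum_comm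
    _ = ∑' μ, (∑' ξ : Fin n → ℤ, latticeWeight ε ξ) * z μ ^ θ := by
        refine tsum_congr fun μ => ?_
        rw [ENNReal.tsum_mul_right, ← (Equiv.subRight μ).tsum_eq (latticeWeight ε)]
        rfl
    _ = _ := ENNReal.tsum_mul_left

lemma tsum_pi_prod_eq {ι : Type*} (f : ι → ℝ≥0∞) (n : ℕ) :
    ∑' ξ : Fin n → ι, ∏ i, f (ξ i) = (∑' m, f m) ^ n := by
  induction n with
  | zero => simp
  | succ n ih =>
    rw [← (Fin.consEquiv fun _ : Fin (n + 1) => ι).tsum_eq, ENNReal.tsum_prod', pow_succ']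
    simp only [Fin.consEquiv, Equiv.coe_fn_mk, Fin.prod_univ_succ, Fin.cons_zero, Fin.cons_succ,
      ENNReal.tsum_mul_left, ih, ENNReal.tsum_mul_right]

lemma tsum_int_two_rpow_neg_abs_ne_top (hε : 0 < ε) :
    ∑' m : ℤ, (2 : ℝ≥0∞) ^ (-(ε * |(m : ℝ)|)) ≠ ∞ := by
  have hpow : ∀ m : ℕ, (2 : ℝ≥0∞) ^ (-(ε * m)) = (2 ^ (-ε)) ^ m := fun m => by
    rw [← ENNReal.rpow_natCast, ← ENNReal.rpow_mul, neg_mul]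
  have hgeometric : ∑' m : ℕ, ((2 : ℝ≥0∞) ^ (-ε)) ^ m ≠ ∞ := by
    rw [ENNReal.tsum_geometric]
    exact ENNReal.inv_ne_top.2 (tsub_pos_of_lt
      (ENNReal.rpow_lt_one_of_one_lt_of_neg (by norm_num) (neg_lt_zero.2 hε))).ne'
  rw [tsum_of_nat_of_neg_add_one ENNReal.summable ENNReal.summable]
  refine ENNReal.add_ne_top.2 ⟨by simpa [hpow] using hgeometric, ?_⟩
  refine ne_top_of_le_ne_top hgeometric (ENNReal.tsum_le_tsum fun m => ?_)
  rw [← hpow]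
  refine ENNReal.rpow_le_rpow_of_exponent_le (by norm_num) ?_
  have habs : |((-((m : ℤ) + 1) : ℤ) : ℝ)| = m + 1 := by
    push_cast
    rw [abs_neg, abs_of_nonneg (by positivity)]
  rw [habs]
  nlinarith

lemma tsum_latticeWeight_ne_top (hε : 0 < ε) : ∑' ξ : Fin n → ℤ, latticeWeight ε ξ ≠ ∞ := by
  simp only [latticeWeight]
  rw [tsum_pi_prod_eq fun m : ℤ => (2 : ℝ≥0∞) ^ (-(ε * |(m : ℝ)|))]
  exact ENNReal.pow_ne_top (tsum_int_two_rpow_neg_abs_ne_top hε)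

lemma one_add_one_sub_inv_mul {ρ : ℝ≥0∞} (hρ : ρ < 1) : 1 + (1 - ρ)⁻¹ * ρ = (1 - ρ)⁻¹ := by
  have hne_zero : 1 - ρ ≠ 0 := (tsub_pos_of_lt hρ).ne'
  have hne_top : 1 - ρ ≠ ∞ := ne_top_of_le_ne_top ENNReal.one_ne_top tsub_le_self
  calc 1 + (1 - ρ)⁻¹ * ρ = (1 - ρ)⁻¹ * ((1 - ρ) + ρ) := by
        rw [mul_add, ENNReal.inv_mul_cancel hne_zero hne_top]
    _ = _ := by rw [tsub_add_cancel_of_le hρ.le, mul_one]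

lemma le_of_exists_step_le {X κ : Type*} (step : κ → X → X) {b G : X → ℝ≥0∞} {r ρ B : ℝ≥0∞}
    (hr : r < 1) (hρ : ρ < 1) (hB : B ≠ ∞) (hb : ∀ ν, b ν ≤ B)
    (hstep : ∀ ν, ∃ k, b ν ≤ G ν + r * b (step k ν))
    (hG : ∀ ν k, r * G (step k ν) ≤ ρ * G ν) (ν : X) :
    b ν ≤ (1 - ρ)⁻¹ * G ν := by
  have hiterate : ∀ (J : ℕ) (ν), b ν ≤ (1 - ρ)⁻¹ * G ν + r ^ J * B := by
    intro J
    induction J with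
    | zero => exact fun ν => by simpa using (hb ν).trans le_add_self
    | succ J ih =>
      intro ν
      obtain ⟨k, hk⟩ := hstep ν
      calc b ν ≤ G ν + r * b (step k ν) := hk
        _ ≤ G ν + r * ((1 - ρ)⁻¹ * G (step k ν) + r ^ J * B) := by gcongr; exact ih _
        _ = G ν + (1 - ρ)⁻¹ * (r * G (step k ν)) + r ^ (J + 1) * B := by ring
        _ ≤ G ν + (1 - ρ)⁻¹ * (ρ * G ν) + r ^ (J + 1) * B := by
            gcongr _ + (1 - ρ)⁻¹ * ?_ + _; exact hG ν k
        _ = (1 + (1 - ρ)⁻¹ * ρ) * G ν + r ^ (J + 1) * B := by ring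
        _ = _ := by rw [one_add_one_sub_inv_mul hρ]
  have hlim : Filter.Tendsto (fun J : ℕ => (1 - ρ)⁻¹ * G ν + r ^ J * B) Filter.atTop
      (nhds ((1 - ρ)⁻¹ * G ν + 0 * B)) :=
    tendsto_const_nhds.add
      (ENNReal.Tendsto.mul_const (ENNReal.tendsto_pow_atTop_nhds_zero_of_lt_one hr) (Or.inr hB))
  rw [zero_mul, add_zero] at hlim
  exact ge_of_tendsto' hlim fun J => hiterate J ν

lemma prod_rpow_eq_rpow_sum {ι : Type*} (s : Finset ι) (x : ℝ≥0∞) {lam : ι → ℝ}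
    (hlam : ∀ i ∈ s, 0 ≤ lam i) : ∏ i ∈ s, x ^ lam i = x ^ ∑ i ∈ s, lam i := by
  induction s using Finset.cons_induction with
  | empty => simp
  | cons a s ha ih =>
    have hs : ∀ i ∈ s, 0 ≤ lam i := fun i hi => hlam i (Finset.mem_cons_of_mem hi)
    rw [Finset.prod_cons, Finset.sum_cons, ih hs,
      ENNReal.rpow_add_of_nonneg _ _ (hlam a (Finset.mem_cons_self a s)) (Finset.sum_nonneg hs)]

lemma exists_le_geom_mean {ι : Type*} [Fintype ι] (x : ι → ℝ≥0∞) {lam : ι → ℝ}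
    (hlam : ∀ i, 0 ≤ lam i) (hsum : ∑ i, lam i = 1) : ∃ k, x k ≤ ∏ i, x i ^ lam i := by
  have hne := Finset.nonempty_of_sum_ne_zero (hsum.trans_ne one_ne_zero)
  obtain ⟨k, -, hk⟩ := Finset.exists_min_image Finset.univ x hne
  refine ⟨k, ?_⟩
  calc x k = ∏ i, x k ^ lam i := by
        rw [prod_rpow_eq_rpow_sum _ _ fun i _ => hlam i, hsum, ENNReal.rpow_one]
    _ ≤ _ := Finset.prod_le_prod' fun i hi => ENNReal.rpow_le_rpow (hk i hi) (hlam i)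

/-- The `ℓ^θ` bound `‖A‖_{ℓ^θ} ≤ M`, `0 < θ ≤ ∞`. -/
def LpSumLe {ι : Type*} (θ : ℝ≥0∞) (A : ι → ℝ≥0∞) (M : ℝ≥0∞) : Prop :=
  if θ = ∞ then ∀ i, A i ≤ M else ∑' i, A i ^ θ.toReal ≤ M ^ θ.toReal

lemma LpSumLe.const_mul {ι : Type*} {θ M : ℝ≥0∞} {A : ι → ℝ≥0∞} (hA : LpSumLe θ A M) (c : ℝ≥0∞) :
    LpSumLe θ (fun i => c * A i) (c * M) := by
  unfold LpSumLe at hA ⊢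
  split_ifs at hA ⊢
  · exact fun i => mul_le_mul_right (hA i) c
  · simp only [ENNReal.mul_rpow_of_nonneg _ _ ENNReal.toReal_nonneg, ENNReal.tsum_mul_left]
    exact mul_le_mul_right hA _

lemma LpSumLe.slowMajorant (hε : 0 ≤ ε) {z : (Fin n → ℤ) → ℝ≥0∞} {θ M : ℝ≥0∞} (hθ : 1 ≤ θ)
    (hz : LpSumLe θ z M) :
    LpSumLe θ (slowMajorant ε z) ((∑' ξ : Fin n → ℤ, latticeWeight ε ξ) * M) := by
  have hmass : 1 ≤ ∑' ξ : Fin n → ℤ, latticeWeight ε ξ :=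
    le_trans (by simp [latticeWeight]) (ENNReal.le_tsum 0)
  unfold LpSumLe at hz ⊢
  split_ifs at hz ⊢ with htop
  · exact fun ν => (slowMajorant_le_of_le hε hz ν).trans (le_mul_of_one_le_left' hmass)
  · have hθ1 : 1 ≤ θ.toReal := by
      rw [← ENNReal.toReal_one]
      exact ENNReal.toReal_mono htop hθ
    refine (tsum_slowMajorant_rpow_le hε z hθ1).trans ?_
    rw [ENNReal.mul_rpow_of_nonneg _ _ (by positivity)]
    exact mul_le_mul' (ENNReal.le_rpow_self_of_one_le hmass hθ1) hz

lemma tsum_prod_rpow_le_prod_tsum_rpow {ι κ : Type*} [Fintype κ] (F : κ → ι → ℝ≥0∞) {e : κ → ℝ}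
    (he : ∀ k, 0 ≤ e k) (hsum : ∑ k, e k = 1) :
    ∑' i, ∏ k, F k i ^ e k ≤ ∏ k, (∑' i, F k i) ^ e k := by
  let _ : MeasurableSpace ι := ⊤
  simpa only [lintegral_count] using ENNReal.lintegral_prod_norm_pow_le (μ := Measure.count)
    Finset.univ (fun k _ => (measurable_from_top (f := F k)).aemeasurable) hsum fun k _ => he k

-- For `θ = ∞` the exponent is `0`, since `∞.toReal⁻¹ = 0`, and `W` carries the whole bound.
lemma LpSumLe.exists_rpow_le_mul {ι : Type*} {θ M : ℝ≥0∞} {A : ι → ℝ≥0∞} (hA : LpSumLe θ A M)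
    (hθ : θ ≠ 0) {lam t : ℝ} (hlam : 0 ≤ lam) (ht : 0 ≤ t) :
    ∃ W : ℝ≥0∞, (∀ i, (A i ^ lam) ^ t ≤ W * (A i ^ θ.toReal) ^ (lam * θ.toReal⁻¹ * t)) ∧
      W * (∑' i, A i ^ θ.toReal) ^ (lam * θ.toReal⁻¹ * t) ≤ (M ^ lam) ^ t := by
  unfold LpSumLe at hA
  split_ifs at hA with htop
  · refine ⟨(M ^ lam) ^ t, fun i => ?_, by simp [htop]⟩
    simpa [htop] using ENNReal.rpow_le_rpow (ENNReal.rpow_le_rpow (hA i) hlam) ht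
  · have hcollapse : ∀ x : ℝ≥0∞,
        (x ^ θ.toReal) ^ (lam * θ.toReal⁻¹ * t) = (x ^ lam) ^ t := fun x => by
      have := ENNReal.toReal_pos hθ htop
      rw [← ENNReal.rpow_mul, ← ENNReal.rpow_mul]
      congr 1
      field_simp
    refine ⟨1, fun i => by rw [one_mul, hcollapse], ?_⟩
    rw [one_mul, ← hcollapse]
    exact ENNReal.rpow_le_rpow hA (by positivity)

lemma tsum_prod_rpow_le {ι κ : Type*} [Fintype κ] {A : κ → ι → ℝ≥0∞} {M : κ → ℝ≥0∞}
    {θ : κ → ℝ≥0∞} (hθ0 : ∀ k, θ k ≠ 0) (hA : ∀ k, LpSumLe (θ k) (A k) (M k)) {lam : κ → ℝ}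
    (hlam : ∀ k, 0 ≤ lam k) {t : ℝ} (ht : 0 < t)
    (hsum : ∑ k, lam k * (θ k).toReal⁻¹ = t⁻¹) :
    ∑' i, (∏ k, A k i ^ lam k) ^ t ≤ (∏ k, M k ^ lam k) ^ t := by
  choose W hpointwise hnorm using fun k =>
    (hA k).exists_rpow_le_mul (hθ0 k) (hlam k) ht.le
  have he : ∀ k, 0 ≤ lam k * (θ k).toReal⁻¹ * t := fun k => by
    have := hlam k
    positivity
  have hesum : ∑ k, lam k * (θ k).toReal⁻¹ * t = 1 := by
    rw [← Finset.sum_mul, hsum, inv_mul_cancel₀ ht.ne']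
  simp only [← ENNReal.prod_rpow_of_nonneg ht.le]
  calc _ ≤ ∑' i, ∏ k, W k * (A k i ^ (θ k).toReal) ^ (lam k * (θ k).toReal⁻¹ * t) :=
        ENNReal.tsum_le_tsum fun i => Finset.prod_le_prod' fun k _ => hpointwise k i
    _ = (∏ k, W k) * ∑' i, ∏ k, (A k i ^ (θ k).toReal) ^ (lam k * (θ k).toReal⁻¹ * t) := by
        simp only [Finset.prod_mul_distrib, ENNReal.tsum_mul_left]
    _ ≤ (∏ k, W k) * ∏ k, (∑' i, A k i ^ (θ k).toReal) ^ (lam k * (θ k).toReal⁻¹ * t) := by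
        gcongr
        exact tsum_prod_rpow_le_prod_tsum_rpow _ he hesum
    _ ≤ _ := by
        rw [← Finset.prod_mul_distrib]
        exact Finset.prod_le_prod' fun k _ => hnorm k

lemma LpSumLe.prod_rpow {ι κ : Type*} [Fintype κ] {A : κ → ι → ℝ≥0∞} {M : κ → ℝ≥0∞}
    {θ : κ → ℝ≥0∞} (hθ0 : ∀ k, θ k ≠ 0) (hA : ∀ k, LpSumLe (θ k) (A k) (M k)) {lam : κ → ℝ}
    (hlam : ∀ k, 0 ≤ lam k) {θm : ℝ≥0∞} (hθm : θm⁻¹ = ∑ k, ENNReal.ofReal (lam k) * (θ k)⁻¹) :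
    LpSumLe θm (fun i => ∏ k, A k i ^ lam k) (∏ k, M k ^ lam k) := by
  have hterm : ∀ k, ENNReal.ofReal (lam k) * (θ k)⁻¹ ≠ ∞ := fun k =>
    ENNReal.mul_ne_top ENNReal.ofReal_ne_top (ENNReal.inv_ne_top.2 (hθ0 k))
  unfold LpSumLe
  split_ifs with htop
  · rw [htop, ENNReal.inv_top, eq_comm, Finset.sum_eq_zero_iff] at hθm
    refine fun i => Finset.prod_le_prod' fun k _ => ?_
    rcases mul_eq_zero.1 (hθm k (Finset.mem_univ k)) with hk | hk
    · simp [le_antisymm (ENNReal.ofReal_eq_zero.1 hk) (hlam k)]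
    · have hAk := hA k
      rw [LpSumLe, if_pos (ENNReal.inv_eq_zero.1 hk)] at hAk
      exact ENNReal.rpow_le_rpow (hAk i) (hlam k)
  · have hθm0 : θm ≠ 0 := by
      rw [← ENNReal.inv_ne_top, hθm]
      exact ENNReal.sum_ne_top.2 fun k _ => hterm k
    refine tsum_prod_rpow_le hθ0 hA hlam (ENNReal.toReal_pos hθm0 htop) ?_
    rw [← ENNReal.toReal_inv, hθm, ENNReal.toReal_sum fun k _ => hterm k]
    simp [ENNReal.toReal_ofReal (hlam _)]

lemma prod_const_mul_rpow {ι : Type*} [Fintype ι] (c : ℝ≥0∞) (x : ι → ℝ≥0∞) {lam : ι → ℝ}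
    (hlam : ∀ i, 0 ≤ lam i) (hsum : ∑ i, lam i = 1) :
    ∏ i, (c * x i) ^ lam i = c * ∏ i, x i ^ lam i := by
  simp only [ENNReal.mul_rpow_of_nonneg _ _ (hlam _), Finset.prod_mul_distrib,
    prod_rpow_eq_rpow_sum _ _ fun i _ => hlam i, hsum, ENNReal.rpow_one]

/-- The weighted geometric mean of the slow majorants of the families `z k`, scaled by
`2^{s (ν_1 + ⋯ + ν_n)}`. -/
noncomputable def geomMajorant {κ : Type*} [Fintype κ] (ε s : ℝ) (lam : κ → ℝ)
    (z : κ → (Fin n → ℤ) → ℝ≥0∞) (ν : Fin n → ℤ) : ℝ≥0∞ :=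
  2 ^ (s * ∑ i, (ν i : ℝ)) * ∏ k, slowMajorant ε (z k) ν ^ lam k

lemma geomMajorant_add_single_le {κ : Type*} [Fintype κ] (hε : 0 ≤ ε) (s : ℝ) {lam : κ → ℝ}
    (hlam : ∀ k, 0 ≤ lam k) (hsum : ∑ k, lam k = 1) (z : κ → (Fin n → ℤ) → ℝ≥0∞)
    (ν : Fin n → ℤ) (i : Fin n) :
    geomMajorant ε s lam z (ν + Pi.single i 1) ≤ 2 ^ (s + ε) * geomMajorant ε s lam z ν := by
  have hexponent : ∑ j, ((ν + Pi.single i 1 : Fin n → ℤ) j : ℝ) = ∑ j, (ν j : ℝ) + 1 := by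
    simp [Finset.sum_add_distrib, Pi.single_apply]
  calc _ ≤ 2 ^ (s * (∑ j, (ν j : ℝ) + 1)) * ∏ k, (2 ^ ε * slowMajorant ε (z k) ν) ^ lam k := by
        rw [geomMajorant, hexponent]
        gcongr with k
        · exact hlam k
        · exact slowMajorant_add_single_le hε (z k) ν i
    _ = _ := by
        rw [prod_const_mul_rpow _ _ hlam hsum, mul_add, mul_one, geomMajorant,
          ENNReal.rpow_add _ _ two_ne_zero ENNReal.ofNat_ne_top,
          ENNReal.rpow_add _ _ two_ne_zero ENNReal.ofNat_ne_top]
        ring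

end Lattice

section Dyadic

variable {n : ℕ}

/-- The dyadic box `∏ [2^{ν_i}, 2^{ν_i + 1})`. -/
def dyadicBox (ν : Fin n → ℤ) : Set (Fin n → ℝ) :=
  univ.pi fun i => Ico ((2 : ℝ) ^ ν i) (2 ^ (ν i + 1))

lemma measurableSet_dyadicBox (ν : Fin n → ℤ) : MeasurableSet (dyadicBox ν) :=
  MeasurableSet.univ_pi fun _ => measurableSet_Ico

lemma volume_dyadicBox (ν : Fin n → ℤ) :
    volume (dyadicBox ν) = ENNReal.ofReal (∏ i, (2 : ℝ) ^ ν i) := by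
  rw [dyadicBox, volume_pi_pi, ENNReal.ofReal_prod_of_nonneg fun i _ => by positivity]
  refine Finset.prod_congr rfl fun i _ => ?_
  rw [Real.volume_Ico, zpow_add_one₀ (by norm_num)]
  congr 1
  ring

lemma pairwise_disjoint_dyadicBox :
    Pairwise (Function.onFun Disjoint (dyadicBox : (Fin n → ℤ) → Set (Fin n → ℝ))) := by
  intro ν μ hνμ
  refine disjoint_left.2 fun x hxν hxμ => hνμ (funext fun i => ?_)
  have hlt : ∀ {ν μ : Fin n → ℤ}, x ∈ dyadicBox ν → x ∈ dyadicBox μ → ν i < μ i + 1 :=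
    fun hxν hxμ => (zpow_lt_zpow_iff_right₀ (one_lt_two (α := ℝ))).1
      ((hxν i (mem_univ i)).1.trans_lt (hxμ i (mem_univ i)).2)
  have := hlt hxν hxμ
  have := hlt hxμ hxν
  omega

lemma posOrthant_subset_iUnion_dyadicBox :
    posOrthant n ⊆ ⋃ ν : Fin n → ℤ, dyadicBox ν := by
  intro x hx
  choose ν hν using fun i => exists_mem_Ico_zpow (hx i) one_lt_two
  exact mem_iUnion.2 ⟨ν, fun i _ => hν i⟩

lemma tsum_setLIntegral_dyadicBox_le (H : (Fin n → ℝ) → ℝ≥0∞) :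
    ∑' ν : Fin n → ℤ, ∫⁻ x in dyadicBox ν, H x ≤ ∫⁻ x, H x := by
  rw [← lintegral_iUnion measurableSet_dyadicBox pairwise_disjoint_dyadicBox]
  exact setLIntegral_le_lintegral _ _

lemma coordMap_two_mem_dyadicBox_iff (k : Fin n) (ν : Fin n → ℤ) (x : Fin n → ℝ) :
    coordMap k (2 * ·) x ∈ dyadicBox (ν + Pi.single k 1) ↔ x ∈ dyadicBox ν := by
  simp only [dyadicBox, mem_univ_pi]
  refine forall_congr' fun i => ?_
  rcases eq_or_ne i k with rfl | hi
  · simp only [coordMap, Function.update_self, Pi.add_apply, Pi.single_eq_same, mem_Ico,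
      zpow_add_one₀ (two_ne_zero (α := ℝ))]
    constructor <;> rintro ⟨hlower, hupper⟩ <;> constructor <;> linarith
  · simp [coordMap, hi]

lemma lintegral_comp_two_mul {h : ℝ → ℝ≥0∞} (hh : Measurable h) :
    ∫⁻ s, h (2 * s) = 2⁻¹ * ∫⁻ s, h s := by
  rw [← lintegral_map hh (measurable_const_mul 2), Real.map_volume_mul_left two_ne_zero,
    lintegral_smul_measure]
  congr 1
  rw [abs_of_pos (by norm_num), ENNReal.ofReal_inv_of_pos (by norm_num)]
  simp

lemma lintegral_comp_coordMap_two_le (k : Fin n) {H : (Fin n → ℝ) → ℝ≥0∞} (hH : Measurable H) :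
    ∫⁻ x, H (coordMap k (2 * ·) x) ≤ 2⁻¹ * ∫⁻ x, H x := by
  rw [← lintegral_const_mul _ hH]
  refine lintegral_le_of_fibre_le k (hH.comp (measurable_coordMap k (by fun_prop)))
    (hH.const_mul _) fun x => ?_
  have hfibre : Measurable fun s : ℝ => H (Function.update x k s) := hH.comp (measurable_update x)
  simp only [coordMap_update]
  rw [lintegral_comp_two_mul hfibre, lintegral_const_mul _ hfibre]

lemma setLIntegral_dyadicBox_comp_coordMap_two_le (k : Fin n) (ν : Fin n → ℤ)
    {H : (Fin n → ℝ) → ℝ≥0∞} (hH : Measurable H) :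
    ∫⁻ x in dyadicBox ν, H (coordMap k (2 * ·) x) ≤
      2⁻¹ * ∫⁻ x in dyadicBox (ν + Pi.single k 1), H x := by
  simp only [← lintegral_indicator (measurableSet_dyadicBox _)]
  calc _ = ∫⁻ x, (dyadicBox (ν + Pi.single k 1)).indicator H (coordMap k (2 * ·) x) := by
        refine lintegral_congr fun x => ?_
        classical
        simp only [indicator_apply, coordMap_two_mem_dyadicBox_iff]
    _ ≤ _ := lintegral_comp_coordMap_two_le k (hH.indicator (measurableSet_dyadicBox _))

/-- The `L^p` norm of `F` over a dyadic box. -/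
noncomputable def boxNorm (p : ℝ) (F : (Fin n → ℝ) → ℝ≥0∞) (ν : Fin n → ℤ) : ℝ≥0∞ :=
  (∫⁻ x in dyadicBox ν, F x ^ p) ^ (1 / p)

/-- The decrease of `F` under doubling of the `k`-th coordinate. -/
noncomputable def doublingGap (k : Fin n) (F : (Fin n → ℝ) → ℝ≥0∞) (x : Fin n → ℝ) : ℝ≥0∞ :=
  F x - F (coordMap k (2 * ·) x)

lemma measurable_doublingGap (k : Fin n) {F : (Fin n → ℝ) → ℝ≥0∞} (hF : Measurable F) :
    Measurable (doublingGap k F) :=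
  hF.sub (hF.comp (measurable_coordMap k (by fun_prop)))

lemma boxNorm_rpow {p : ℝ} (hp : 0 < p) (F : (Fin n → ℝ) → ℝ≥0∞) (ν : Fin n → ℤ) :
    boxNorm p F ν ^ p = ∫⁻ x in dyadicBox ν, F x ^ p := by
  rw [boxNorm, ← ENNReal.rpow_mul, one_div_mul_cancel hp.ne', ENNReal.rpow_one]

lemma boxNorm_le_lintegral {p : ℝ} (hp : 0 ≤ p) (F : (Fin n → ℝ) → ℝ≥0∞) (ν : Fin n → ℤ) :
    boxNorm p F ν ≤ (∫⁻ x, F x ^ p) ^ (1 / p) :=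
  ENNReal.rpow_le_rpow (setLIntegral_le_lintegral _ _) (by positivity)

lemma boxNorm_le_doublingGap_add {p : ℝ} (hp : 1 ≤ p) {F : (Fin n → ℝ) → ℝ≥0∞}
    (hF : Measurable F) (k : Fin n) (ν : Fin n → ℤ) :
    boxNorm p F ν ≤ boxNorm p (doublingGap k F) ν +
      2 ^ (-(1 / p)) * boxNorm p F (ν + Pi.single k 1) := by
  have : 0 < p := by positivity
  have hdoubled : (∫⁻ x in dyadicBox ν, F (coordMap k (2 * ·) x) ^ p) ^ (1 / p) ≤
      2 ^ (-(1 / p)) * boxNorm p F (ν + Pi.single k 1) := by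
    rw [boxNorm, ENNReal.rpow_neg, ← ENNReal.inv_rpow,
      ← ENNReal.mul_rpow_of_nonneg _ _ (by positivity)]
    exact ENNReal.rpow_le_rpow
      (setLIntegral_dyadicBox_comp_coordMap_two_le k ν (hF.pow_const p)) (by positivity)
  calc boxNorm p F ν
      ≤ (∫⁻ x in dyadicBox ν, (doublingGap k F x + F (coordMap k (2 * ·) x)) ^ p) ^ (1 / p) := by
        unfold boxNorm
        gcongr with x
        exact le_tsub_add
    _ ≤ boxNorm p (doublingGap k F) ν +
          (∫⁻ x in dyadicBox ν, F (coordMap k (2 * ·) x) ^ p) ^ (1 / p) :=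
        ENNReal.lintegral_Lp_add_le (measurable_doublingGap k hF).aemeasurable
          (hF.comp (measurable_coordMap k (by fun_prop))).aemeasurable hp
    _ ≤ _ := by gcongr

lemma tailWeight_le_two_mul {δ s t : ℝ} (hδ : 0 < δ) (hst : s ≤ t) (hts : t ≤ 2 * s) :
    tailWeight δ s ≤ 2 * tailWeight δ t := by
  rcases lt_or_ge s δ with hs | hs
  · simp [tailWeight_of_lt hs]
  have hs0 : 0 < s := hδ.trans_le hs
  have ht0 : 0 < t := hs0.trans_le hst
  rw [tailWeight_of_le hs, tailWeight_of_le (hs.trans hst), ← ENNReal.ofReal_ofNat,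
    ← ENNReal.ofReal_mul zero_le_two]
  refine ENNReal.ofReal_le_ofReal ?_
  rw [← mul_div_assoc, div_le_div_iff₀ hs0 ht0]
  nlinarith

lemma tailWeight_mul_boxNorm_rpow_le {p δ : ℝ} (hp : 0 < p) (hδ : 0 < δ) (k : Fin n)
    {D : (Fin n → ℝ) → ℝ≥0∞} (hD : Measurable D) (ν : Fin n → ℤ) :
    (tailWeight δ (2 ^ ν k) * boxNorm p D ν) ^ p ≤
      2 ^ p * ∫⁻ x in dyadicBox ν, (tailWeight δ (x k) * D x) ^ p := by
  rw [ENNReal.mul_rpow_of_nonneg _ _ hp.le, boxNorm_rpow hp,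
    ← lintegral_const_mul _ (hD.pow_const p),
    ← lintegral_const_mul' _ _ (ENNReal.rpow_ne_top_of_nonneg hp.le (by norm_num))]
  refine setLIntegral_mono' (measurableSet_dyadicBox ν) fun x hx => ?_
  obtain ⟨hlower, hupper⟩ := hx k (mem_univ k)
  rw [zpow_add_one₀ two_ne_zero, mul_comm] at hupper
  simp only [← ENNReal.mul_rpow_of_nonneg _ _ hp.le, ← mul_assoc]
  gcongr
  exact tailWeight_le_two_mul hδ hlower hupper.le

lemma tsum_tailWeight_mul_boxNorm_rpow_le {p θ δ : ℝ} (hp : 0 < p) (hθ : p ≤ θ) (hδ : 0 < δ)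
    (k : Fin n) {D : (Fin n → ℝ) → ℝ≥0∞} (hD : Measurable D) {ω : ℝ≥0∞}
    (hω : ∫⁻ x, (tailWeight δ (x k) * D x) ^ p ≤ ω ^ p) :
    ∑' ν : Fin n → ℤ, (tailWeight δ (2 ^ ν k) * boxNorm p D ν) ^ θ ≤ (2 * ω) ^ θ := by
  have hsum : ∑' ν : Fin n → ℤ, (tailWeight δ (2 ^ ν k) * boxNorm p D ν) ^ p ≤ (2 * ω) ^ p := by
    rw [ENNReal.mul_rpow_of_nonneg _ _ hp.le]
    refine (ENNReal.tsum_le_tsum (tailWeight_mul_boxNorm_rpow_le hp hδ k hD)).trans ?_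
    rw [ENNReal.tsum_mul_left]
    gcongr
    exact (tsum_setLIntegral_dyadicBox_le _).trans hω
  have hpow : ∀ y : ℝ≥0∞, y ^ θ = (y ^ p) ^ (θ / p) := fun y => by
    rw [← ENNReal.rpow_mul, mul_div_cancel₀ _ hp.ne']
  simp_rw [hpow]
  exact (tsum_rpow_le_rpow_tsum _ ((one_le_div hp).2 hθ)).trans
    (ENNReal.rpow_le_rpow hsum (div_nonneg (hp.le.trans hθ) hp.le))

lemma lintegral_rpow_sub_one_Ioc {A s : ℝ} (hA : 0 < A) (hs : 0 < s) :
    ∫⁻ t in Ioc 0 A, ENNReal.ofReal (t ^ (s - 1)) = ENNReal.ofReal (A ^ s / s) := by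
  have hintegrable : IntervalIntegrable (fun t : ℝ => t ^ (s - 1)) volume 0 A :=
    intervalIntegral.intervalIntegrable_rpow' (by linarith)
  have hval : ∫ t in (0 : ℝ)..A, t ^ (s - 1) = A ^ s / s := by
    rw [integral_rpow (Or.inl (by linarith)), sub_add_cancel, Real.zero_rpow hs.ne', sub_zero]
  rw [← hval, intervalIntegral.integral_of_le hA.le, ofReal_integral_eq_lintegral_ofReal
    ((intervalIntegrable_iff_integrableOn_Ioc_of_le hA.le).1 hintegrable)]
  exact (ae_restrict_iff' measurableSet_Ioc).2
    (Filter.Eventually.of_forall fun t ht => Real.rpow_nonneg ht.1.le _)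

lemma measurable_tailWeight_left (t : ℝ) : Measurable fun δ => tailWeight δ t := by
  have hindicator : (fun δ => tailWeight δ t) =
      (Iic t).indicator fun δ => ENNReal.ofReal (δ / t) := by
    funext δ
    by_cases hδ : δ ≤ t
    · rw [tailWeight_of_le hδ, indicator_of_mem (show δ ∈ Iic t from hδ)]
    · rw [tailWeight_of_lt (not_le.1 hδ), indicator_of_notMem (show δ ∉ Iic t from hδ)]
  rw [hindicator]
  exact Measurable.indicator (by fun_prop) measurableSet_Iic

lemma ofReal_rpow_mul_tailWeight_rpow_div {α θ A δ : ℝ} (hθ : 0 ≤ θ) (hδ : 0 < δ) (hδA : δ ≤ A) :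
    (ENNReal.ofReal (δ ^ (-α)) * tailWeight δ A) ^ θ / ENNReal.ofReal δ =
      ENNReal.ofReal (A ^ (-θ)) * ENNReal.ofReal (δ ^ ((1 - α) * θ - 1)) := by
  have hA : 0 < A := hδ.trans_le hδA
  rw [tailWeight_of_le hδA, ← ENNReal.ofReal_mul (by positivity),
    ENNReal.ofReal_rpow_of_nonneg (by positivity) hθ, ← ENNReal.ofReal_div_of_pos hδ,
    ← ENNReal.ofReal_mul (by positivity)]
  have hbase : δ ^ (-α) * (δ / A) = δ ^ (1 - α) / A := by
    rw [← mul_div_assoc, ← Real.rpow_add_one hδ.ne', neg_add_eq_sub]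
  rw [hbase, Real.div_rpow (by positivity) hA.le, ← Real.rpow_mul hδ.le, Real.rpow_sub_one hδ.ne',
    Real.rpow_neg hA.le]
  congr 1
  ring

lemma lintegral_tailWeight_rpow {α θ A : ℝ} (hα : α < 1) (hθ : 0 < θ) (hA : 0 < A) :
    ∫⁻ δ in Ioi (0 : ℝ), (ENNReal.ofReal (δ ^ (-α)) * tailWeight δ A) ^ θ / ENNReal.ofReal δ =
      ENNReal.ofReal ((1 - α) * θ)⁻¹ * ENNReal.ofReal (A ^ (-α)) ^ θ := by
  have hs : 0 < (1 - α) * θ := mul_pos (by linarith) hθ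
  calc _ = ∫⁻ δ in Ioc 0 A, (ENNReal.ofReal (δ ^ (-α)) * tailWeight δ A) ^ θ /
        ENNReal.ofReal δ := by
        rw [← Ioc_union_Ioi_eq_Ioi hA.le, lintegral_union measurableSet_Ioi
          (Ioc_disjoint_Ioi le_rfl), setLIntegral_congr_fun measurableSet_Ioi
          (g := fun _ => (0 : ℝ≥0∞)) fun δ hδ => by simp [tailWeight_of_lt hδ, hθ]]
        simp
    _ = ENNReal.ofReal (A ^ (-θ)) * ENNReal.ofReal (A ^ ((1 - α) * θ) / ((1 - α) * θ)) := by
        rw [← lintegral_rpow_sub_one_Ioc hA hs, ← lintegral_const_mul _ (by fun_prop)]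
        exact setLIntegral_congr_fun measurableSet_Ioc fun δ hδ =>
          ofReal_rpow_mul_tailWeight_rpow_div hθ.le hδ.1 hδ.2
    _ = _ := by
        rw [ENNReal.ofReal_rpow_of_nonneg (by positivity) hθ.le,
          ← ENNReal.ofReal_mul (by positivity), ← ENNReal.ofReal_mul (by positivity),
          ← Real.rpow_mul hA.le, mul_div_assoc', ← Real.rpow_add hA, div_eq_inv_mul]
        congr 3
        ring

lemma tsum_two_rpow_mul_rpow_eq_lintegral {ι : Type*} [Countable ι] {α θ : ℝ} (hα : α < 1)
    (hθ : 0 < θ) (m : ι → ℤ) (b : ι → ℝ≥0∞) :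
    ENNReal.ofReal ((1 - α) * θ)⁻¹ * ∑' i, (2 ^ (-(α * m i)) * b i) ^ θ =
      ∫⁻ δ in Ioi (0 : ℝ), ∑' i,
        (ENNReal.ofReal (δ ^ (-α)) * (tailWeight δ (2 ^ m i) * b i)) ^ θ / ENNReal.ofReal δ := by
  have hmeas := measurable_tailWeight_left
  rw [lintegral_tsum fun i => by fun_prop, ← ENNReal.tsum_mul_left]
  refine tsum_congr fun i => ?_
  have hscale : (2 : ℝ≥0∞) ^ (-(α * m i)) = ENNReal.ofReal (((2 : ℝ) ^ m i) ^ (-α)) := by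
    rw [← Real.rpow_intCast, ← Real.rpow_mul two_pos.le, ← ENNReal.ofReal_rpow_of_pos two_pos,
      ENNReal.ofReal_ofNat]
    congr 1
    ring
  rw [hscale, ENNReal.mul_rpow_of_nonneg _ _ hθ.le, ← mul_assoc,
    ← lintegral_tailWeight_rpow hα hθ (by positivity), ← lintegral_mul_const _ (by fun_prop)]
  refine lintegral_congr fun δ => ?_
  rw [← mul_assoc, ENNReal.mul_rpow_of_nonneg _ (b i) hθ.le]
  simp only [div_eq_mul_inv]
  ring

end Dyadic

section Embedding

variable {n : ℕ}

/-- The `L^p` norms over the dyadic boxes of the decrease of `F` under doubling of the `k`-th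
coordinate, scaled to smoothness `α`: their `ℓ^θ` norm is a discrete counterpart of the partial
Besov seminorm. -/
noncomputable def scaledGapNorm (α p : ℝ) (k : Fin n) (F : (Fin n → ℝ) → ℝ≥0∞)
    (ν : Fin n → ℤ) : ℝ≥0∞ :=
  2 ^ (-(α * ν k)) * boxNorm p (doublingGap k F) ν

lemma lintegral_tailWeight_doublingGap_le {f : (Fin n → ℝ) → ℝ} (hf : Measurable f)
    (σ : Equiv.Perm (Fin n)) (k : Fin n) {δ : ℝ} (hδ : 0 < δ) {p : ℝ} (hp : 1 ≤ p) :
    ∫⁻ x, (tailWeight δ (x k) * doublingGap k (iteratedRearrangement σ f) x) ^ p ≤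
      (48 * partialModulus p k f δ) ^ p := by
  have hp0 : 0 ≤ p := by positivity
  refine (lintegral_tailWeight_iteratedRearrangement_le hf σ k hδ hp).trans ?_
  rw [ENNReal.mul_rpow_of_nonneg _ _ hp0]
  gcongr
  calc (4 : ℝ≥0∞) * 12 ^ p ≤ 4 ^ p * 12 ^ p := by
        gcongr
        exact ENNReal.le_rpow_self_of_one_le (by norm_num) hp
    _ = 48 ^ p := by
        rw [← ENNReal.mul_rpow_of_nonneg _ _ hp0]
        norm_num

lemma tsum_tailWeight_mul_boxNorm_doublingGap_le {f : (Fin n → ℝ) → ℝ} (hf : Measurable f)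
    (σ : Equiv.Perm (Fin n)) (k : Fin n) {δ : ℝ} (hδ : 0 < δ) {p θ : ℝ} (hp : 1 ≤ p)
    (hθ : p ≤ θ) :
    ∑' ν : Fin n → ℤ, (tailWeight δ (2 ^ ν k) *
        boxNorm p (doublingGap k (iteratedRearrangement σ f)) ν) ^ θ ≤
      (96 * partialModulus p k f δ) ^ θ := by
  refine (tsum_tailWeight_mul_boxNorm_rpow_le (by positivity) hθ hδ k
    (measurable_doublingGap k (measurable_iteratedRearrangement hf σ))
    (lintegral_tailWeight_doublingGap_le hf σ k hδ hp)).trans_eq ?_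
  rw [← mul_assoc]
  norm_num

lemma boxNorm_doublingGap_le {f : (Fin n → ℝ) → ℝ} (hf : Measurable f)
    (σ : Equiv.Perm (Fin n)) (k : Fin n) {p : ℝ} (hp : 1 ≤ p) (ν : Fin n → ℤ) :
    boxNorm p (doublingGap k (iteratedRearrangement σ f)) ν ≤
      96 * partialModulus p k f (2 ^ ν k) := by
  have hδ : (0 : ℝ) < 2 ^ ν k := by positivity
  have hterm := (ENNReal.le_tsum ν).trans
    (tsum_tailWeight_mul_boxNorm_doublingGap_le hf σ k hδ hp le_rfl)
  rwa [ENNReal.rpow_le_rpow_iff (by positivity), tailWeight_of_le le_rfl, div_self hδ.ne',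
    ENNReal.ofReal_one, one_mul] at hterm

lemma scaledGapNorm_le_besovSeminorm_top {f : (Fin n → ℝ) → ℝ} (hf : Measurable f)
    (σ : Equiv.Perm (Fin n)) (k : Fin n) {p : ℝ} (hp : 1 ≤ p) (α : ℝ) (ν : Fin n → ℤ) :
    scaledGapNorm α p k (iteratedRearrangement σ f) ν ≤ 96 * besovSeminorm α p ∞ k f := by
  have hδ : (0 : ℝ) < 2 ^ ν k := by positivity
  have hscale : (2 : ℝ≥0∞) ^ (-(α * ν k)) = (ENNReal.ofReal (((2 : ℝ) ^ ν k) ^ α))⁻¹ := by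
    rw [← Real.rpow_intCast, ← Real.rpow_mul two_pos.le, ← ENNReal.ofReal_rpow_of_pos two_pos,
      ENNReal.ofReal_ofNat, ← ENNReal.rpow_neg, mul_comm]
  calc _ ≤ (ENNReal.ofReal (((2 : ℝ) ^ ν k) ^ α))⁻¹ *
        (96 * partialModulus p k f (2 ^ ν k)) := by
        rw [scaledGapNorm, hscale]
        gcongr
        exact boxNorm_doublingGap_le hf σ k hp ν
    _ = 96 * (partialModulus p k f (2 ^ ν k) / ENNReal.ofReal (((2 : ℝ) ^ ν k) ^ α)) := by
        rw [div_eq_mul_inv]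
        ring
    _ ≤ _ := by
        rw [besovSeminorm, if_pos rfl]
        gcongr
        exact le_iSup₂_of_le (f := fun (δ : ℝ) (_ : 0 < δ) =>
          partialModulus p k f δ / ENNReal.ofReal (δ ^ α)) (2 ^ ν k) hδ le_rfl

lemma tsum_scaledGapNorm_rpow_le {f : (Fin n → ℝ) → ℝ} (hf : Measurable f)
    (σ : Equiv.Perm (Fin n)) (k : Fin n) {p θ α : ℝ} (hp : 1 ≤ p) (hθ : p ≤ θ) (hα : α < 1) :
    ENNReal.ofReal ((1 - α) * θ)⁻¹ *
        ∑' ν, scaledGapNorm α p k (iteratedRearrangement σ f) ν ^ θ ≤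
      96 ^ θ * ∫⁻ t in Ioi (0 : ℝ),
        (ENNReal.ofReal (t ^ (-α)) * partialModulus p k f t) ^ θ / ENNReal.ofReal t := by
  have hθ0 : 0 < θ := by linarith
  simp only [scaledGapNorm]
  rw [tsum_two_rpow_mul_rpow_eq_lintegral hα hθ0 (fun ν : Fin n → ℤ => ν k),
    ← lintegral_const_mul' _ _ (ENNReal.rpow_ne_top_of_nonneg hθ0.le (by norm_num))]
  refine setLIntegral_mono' measurableSet_Ioi fun δ hδ => ?_
  have hgap := tsum_tailWeight_mul_boxNorm_doublingGap_le hf σ k hδ hp hθ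
  rw [ENNReal.mul_rpow_of_nonneg 96 _ hθ0.le] at hgap
  simp_rw [ENNReal.mul_rpow_of_nonneg (ENNReal.ofReal (δ ^ (-α))) _ hθ0.le, div_eq_mul_inv]
  rw [ENNReal.tsum_mul_right, ENNReal.tsum_mul_left]
  calc _ ≤ ENNReal.ofReal (δ ^ (-α)) ^ θ * (96 ^ θ * partialModulus p k f δ ^ θ) *
        (ENNReal.ofReal δ)⁻¹ := by gcongr
    _ = _ := by ring

lemma ofReal_le_two_rpow {t : ℝ} (ht : 1 ≤ t) : ENNReal.ofReal t ≤ 2 ^ t := by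
  rw [← ENNReal.ofReal_ofNat, ENNReal.ofReal_rpow_of_pos two_pos]
  refine ENNReal.ofReal_le_ofReal ?_
  have hbernoulli := one_add_mul_self_le_rpow_one_add (s := 1) (by norm_num) ht
  norm_num at hbernoulli
  linarith

lemma besovSeminorm_rpow {f : (Fin n → ℝ) → ℝ} {α p : ℝ} {θ : ℝ≥0∞} (k : Fin n) (hθ0 : θ ≠ 0)
    (hθ : θ ≠ ∞) :
    besovSeminorm α p θ k f ^ θ.toReal = ∫⁻ t in Ioi (0 : ℝ),
      (ENNReal.ofReal (t ^ (-α)) * partialModulus p k f t) ^ θ.toReal / ENNReal.ofReal t := by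
  rw [besovSeminorm, if_neg hθ, ← ENNReal.rpow_mul,
    one_div_mul_cancel (ENNReal.toReal_pos hθ0 hθ).ne', ENNReal.rpow_one]

lemma lpSumLe_scaledGapNorm {f : (Fin n → ℝ) → ℝ} (hf : Measurable f)
    (σ : Equiv.Perm (Fin n)) (k : Fin n) {p α : ℝ} {θ : ℝ≥0∞} (hp : 1 ≤ p)
    (hθ : ENNReal.ofReal p ≤ θ) (hα : α < 1) :
    LpSumLe θ (scaledGapNorm α p k (iteratedRearrangement σ f))
      (192 * (ENNReal.ofReal ((1 - α) ^ (1 / θ).toReal) * besovSeminorm α p θ k f)) := by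
  unfold LpSumLe
  split_ifs with htop
  · intro ν
    subst htop
    simpa using (scaledGapNorm_le_besovSeminorm_top hf σ k hp α ν).trans
      (mul_le_mul_left (by norm_num) _)
  have hθ0 : θ ≠ 0 := ((ENNReal.ofReal_pos.2 (by positivity)).trans_le hθ).ne'
  have hθp : p ≤ θ.toReal := (ENNReal.ofReal_le_iff_le_toReal htop).1 hθ
  have hα1 : 0 < 1 - α := by linarith
  set t := θ.toReal with ht
  have ht0 : 0 < t := by linarith
  have hfactor : ENNReal.ofReal ((1 - α) ^ (1 / θ).toReal) ^ t = ENNReal.ofReal (1 - α) := by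
    rw [ENNReal.ofReal_rpow_of_nonneg (by positivity) ht0.le, ← Real.rpow_mul hα1.le, one_div,
      ENNReal.toReal_inv, ← ht, inv_mul_cancel₀ ht0.ne', Real.rpow_one]
  rw [ENNReal.mul_rpow_of_nonneg _ _ ht0.le, ENNReal.mul_rpow_of_nonneg _ _ ht0.le, hfactor,
    besovSeminorm_rpow k hθ0 htop, ← ht]
  have hscaled := tsum_scaledGapNorm_rpow_le hf σ k hp hθp hα
  rw [ENNReal.ofReal_inv_of_pos (by positivity),
    ENNReal.inv_mul_le_iff (ENNReal.ofReal_pos.2 (by positivity)).ne' ENNReal.ofReal_ne_top,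
    ENNReal.ofReal_mul hα1.le] at hscaled
  refine hscaled.trans ?_
  rw [show (192 : ℝ≥0∞) = 2 * 96 by norm_num, ENNReal.mul_rpow_of_nonneg _ _ ht0.le]
  calc _ ≤ ENNReal.ofReal (1 - α) * 2 ^ t * (96 ^ t * _) := by
        gcongr
        exact ofReal_le_two_rpow (hp.trans hθp)
    _ = _ := by ring

lemma partialModulus_congr_ae {f g : (Fin n → ℝ) → ℝ} (hfg : f =ᵐ[volume] g) (p : ℝ) (k : Fin n)
    (δ : ℝ) : partialModulus p k f δ = partialModulus p k g δ := by
  unfold partialModulus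
  refine iSup_congr fun h => iSup_congr fun _ => eLpNorm_congr_ae (.sub ?_ hfg)
  exact (measurePreserving_add_right (volume : Measure (Fin n → ℝ))
    (Pi.single k h)).quasiMeasurePreserving.ae_eq_comp hfg

lemma besovSeminorm_congr_ae {f g : (Fin n → ℝ) → ℝ} (hfg : f =ᵐ[volume] g) (α p : ℝ)
    (θ : ℝ≥0∞) (k : Fin n) : besovSeminorm α p θ k f = besovSeminorm α p θ k g := by
  simp only [besovSeminorm, partialModulus_congr_ae hfg]

lemma modLorentzNorm_congr_ae {f g : (Fin n → ℝ) → ℝ} (hfg : f =ᵐ[volume] g) (q : ℝ) (r : ℝ≥0∞)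
    (σ : Equiv.Perm (Fin n)) : modLorentzNorm q r σ f = modLorentzNorm q r σ g := by
  have hR : iteratedRearrangement σ f =ᵐ[volume.restrict (posOrthant n)]
      iteratedRearrangement σ g := ae_restrict_of_ae (iteratedRearrangement_congr_ae hfg σ)
  unfold modLorentzNorm
  congr 1
  · exact essSup_congr_ae (hR.mono fun t ht => by simp only [ht])
  · congr 1
    exact lintegral_congr_ae (hR.mono fun t ht => by simp only [ht])

lemma prod_boxNorm_doublingGap_rpow_le (ε p : ℝ) {s : ℝ} {lam β : Fin n → ℝ}
    (hlam : ∀ k, 0 ≤ lam k) (hs : ∀ k, lam k * β k = s) (F : (Fin n → ℝ) → ℝ≥0∞)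
    (ν : Fin n → ℤ) :
    ∏ k, boxNorm p (doublingGap k F) ν ^ lam k ≤
      geomMajorant ε s lam (fun k => scaledGapNorm (β k) p k F) ν := by
  have hscale : ∀ k, boxNorm p (doublingGap k F) ν ^ lam k =
      2 ^ (s * ν k) * scaledGapNorm (β k) p k F ν ^ lam k := fun k => by
    rw [scaledGapNorm, ENNReal.mul_rpow_of_nonneg _ _ (hlam k), ← ENNReal.rpow_mul, ← mul_assoc,
      ← ENNReal.rpow_add _ _ two_ne_zero ENNReal.ofNat_ne_top, ← hs k,
      show lam k * β k * ν k + -(β k * ν k) * lam k = 0 by ring, ENNReal.rpow_zero, one_mul]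
  have hpow : ∏ k, (2 : ℝ≥0∞) ^ (s * ν k) = 2 ^ (s * ∑ k, (ν k : ℝ)) := by
    have hreal : ∀ x : ℝ, (2 : ℝ≥0∞) ^ x = ENNReal.ofReal (2 ^ x) := fun x => by
      rw [← ENNReal.ofReal_rpow_of_pos two_pos, ENNReal.ofReal_ofNat]
    simp only [hreal, Finset.mul_sum, Real.rpow_sum_of_pos two_pos]
    exact (ENNReal.ofReal_prod_of_nonneg fun k _ => by positivity).symm
  rw [geomMajorant, ← hpow, ← Finset.prod_mul_distrib]
  refine Finset.prod_le_prod' fun k _ => ?_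
  rw [hscale]
  gcongr
  · exact hlam k
  · exact le_slowMajorant ε _ ν

lemma boxNorm_le_geomMajorant {ε p s : ℝ} {lam β : Fin n → ℝ} (hp : 1 ≤ p) (hε : 0 < ε)
    (hlam : ∀ k, 0 ≤ lam k) (hsum : ∑ k, lam k = 1) (hs : ∀ k, lam k * β k = s)
    (hsε : s + 2 * ε ≤ 1 / p) {F : (Fin n → ℝ) → ℝ≥0∞} (hF : Measurable F)
    (hFp : ∫⁻ x, F x ^ p ≠ ∞) (ν : Fin n → ℤ) :
    boxNorm p F ν ≤
      (1 - 2 ^ (-ε))⁻¹ * geomMajorant ε s lam (fun k => scaledGapNorm (β k) p k F) ν := by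
  have hp0 : 0 < p := by positivity
  have htwo_lt : ∀ {x : ℝ}, 0 < x → (2 : ℝ≥0∞) ^ (-x) < 1 := fun hx =>
    ENNReal.rpow_lt_one_of_one_lt_of_neg (by norm_num) (neg_lt_zero.2 hx)
  refine le_of_exists_step_le (fun k ν => ν + Pi.single k 1) (htwo_lt (one_div_pos.2 hp0))
    (htwo_lt hε) (ENNReal.rpow_ne_top_of_nonneg (by positivity) hFp)
    (boxNorm_le_lintegral hp0.le F) (fun ν => ?_) (fun ν k => ?_) ν
  · obtain ⟨k, hk⟩ := exists_le_geom_mean (fun k => boxNorm p (doublingGap k F) ν) hlam hsum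
    refine ⟨k, (boxNorm_le_doublingGap_add hp hF k ν).trans ?_⟩
    gcongr
    exact hk.trans (prod_boxNorm_doublingGap_rpow_le ε p hlam hs F ν)
  · set G := geomMajorant ε s lam fun k => scaledGapNorm (β k) p k F
    calc _ ≤ 2 ^ (-(1 / p)) * (2 ^ (s + ε) * G ν) := by
          gcongr
          exact geomMajorant_add_single_le hε.le s hlam hsum _ ν k
      _ = 2 ^ (-(1 / p) + (s + ε)) * G ν := by
          rw [ENNReal.rpow_add (-(1 / p)) _ two_ne_zero ENNReal.ofNat_ne_top, mul_assoc]
      _ ≤ _ := by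
          gcongr
          · exact one_le_two
          · linarith

lemma ofReal_prod_rpow_le {ν : Fin n → ℤ} {t : Fin n → ℝ} (ht : t ∈ dyadicBox (ν + 1)) {a : ℝ}
    (ha : 0 ≤ a) (ha1 : a ≤ 1) :
    ENNReal.ofReal ((∏ i, t i) ^ a) ≤ 4 ^ n * 2 ^ (a * ∑ i, (ν i : ℝ)) := by
  have ht0 : ∀ i, 0 ≤ t i := fun i => le_trans (by positivity) (ht i (mem_univ i)).1
  have hfactor : ∀ i, t i ^ a ≤ 4 * 2 ^ (a * ν i) := fun i => by
    calc t i ^ a ≤ (4 * 2 ^ (ν i : ℝ)) ^ a := by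
          refine Real.rpow_le_rpow (ht0 i) ((ht i (mem_univ i)).2.le.trans_eq ?_) ha
          rw [Real.rpow_intCast, Pi.add_apply, Pi.one_apply, zpow_add_one₀ two_ne_zero,
            zpow_add_one₀ two_ne_zero]
          ring
      _ = 4 ^ a * 2 ^ (a * ν i) := by
          rw [Real.mul_rpow (by norm_num) (by positivity), ← Real.rpow_mul two_pos.le,
            mul_comm a]
      _ ≤ _ := by
          gcongr
          exact (Real.rpow_le_rpow_of_exponent_le (by norm_num) ha1).trans_eq (Real.rpow_one 4)
  have hprod : (∏ i, t i) ^ a ≤ 4 ^ n * 2 ^ (a * ∑ i, (ν i : ℝ)) := by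
    calc (∏ i, t i) ^ a = ∏ i, t i ^ a := (Real.finsetProd_rpow _ _ (fun i _ => ht0 i) a).symm
      _ ≤ ∏ i : Fin n, (4 * 2 ^ (a * ν i)) :=
          Finset.prod_le_prod (fun i _ => Real.rpow_nonneg (ht0 i) a) fun i _ => hfactor i
      _ = _ := by simp [Finset.prod_mul_distrib, Finset.mul_sum, Real.rpow_sum_of_pos two_pos]
  refine (ENNReal.ofReal_le_ofReal hprod).trans_eq ?_
  rw [ENNReal.ofReal_mul (by positivity), ENNReal.ofReal_pow (by norm_num),
    ← ENNReal.ofReal_rpow_of_pos two_pos, ENNReal.ofReal_ofNat, ENNReal.ofReal_ofNat]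

lemma iteratedRearrangement_mul_le_boxNorm (σ : Equiv.Perm (Fin n)) (f : (Fin n → ℝ) → ℝ) {p : ℝ}
    (hp : 0 < p) {ν : Fin n → ℤ} {t : Fin n → ℝ} (ht : t ∈ dyadicBox (ν + 1)) :
    2 ^ (1 / p * ∑ i, (ν i : ℝ)) * iteratedRearrangement σ f t ≤
      boxNorm p (iteratedRearrangement σ f) ν := by
  have hvol : volume (dyadicBox ν) = 2 ^ (∑ i, (ν i : ℝ)) := by
    rw [volume_dyadicBox, ← ENNReal.ofReal_ofNat, ENNReal.ofReal_rpow_of_pos two_pos,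
      Real.rpow_sum_of_pos two_pos]
    simp_rw [Real.rpow_intCast]
  rw [← ENNReal.rpow_le_rpow_iff hp, boxNorm_rpow hp, ENNReal.mul_rpow_of_nonneg _ _ hp.le,
    ← ENNReal.rpow_mul, mul_right_comm, one_div_mul_cancel hp.ne', one_mul, ← hvol, mul_comm,
    ← setLIntegral_const]
  refine setLIntegral_mono' (measurableSet_dyadicBox ν) fun s hs => ?_
  refine ENNReal.rpow_le_rpow (iteratedRearrangement_antitone σ f (fun i => ?_) fun i => ?_) hp.le
  · exact lt_of_lt_of_le (by positivity) (hs i (mem_univ i)).1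
  · exact (hs i (mem_univ i)).2.le.trans (ht i (mem_univ i)).1

lemma iteratedRearrangement_le_prod_slowMajorant {f : (Fin n → ℝ) → ℝ} (hf : Measurable f)
    (σ : Equiv.Perm (Fin n)) {ε p s : ℝ} {lam β : Fin n → ℝ} (hp : 1 ≤ p)
    (hfp : ∫⁻ x, ‖f x‖ₑ ^ p ≠ ∞) (hε : 0 < ε) (hlam : ∀ k, 0 ≤ lam k) (hsum : ∑ k, lam k = 1)
    (hs0 : 0 ≤ s) (hs : ∀ k, lam k * β k = s) (hsε : s + 2 * ε ≤ 1 / p) {ν : Fin n → ℤ}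
    {t : Fin n → ℝ} (ht : t ∈ dyadicBox (ν + 1)) :
    ENNReal.ofReal ((∏ i, t i) ^ (1 / p - s)) * iteratedRearrangement σ f t ≤
      4 ^ n * (1 - 2 ^ (-ε))⁻¹ *
        ∏ k, slowMajorant ε (scaledGapNorm (β k) p k (iteratedRearrangement σ f)) ν ^ lam k := by
  have hp0 : 0 < p := by positivity
  have hp1 : 1 / p ≤ 1 := (div_le_one hp0).2 hp
  have hRp : ∫⁻ x, iteratedRearrangement σ f x ^ p ≠ ∞ :=
    ne_top_of_le_ne_top hfp (lintegral_iteratedRearrangement_rpow_le hf σ hp)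
  have hbox := (iteratedRearrangement_mul_le_boxNorm σ f hp0 ht).trans
    (boxNorm_le_geomMajorant hp hε hlam hsum hs hsε (measurable_iteratedRearrangement hf σ) hRp ν)
  set N : ℝ := ∑ i, (ν i : ℝ)
  calc _ ≤ 4 ^ n * 2 ^ ((1 / p - s) * N) * iteratedRearrangement σ f t := by
        gcongr
        exact ofReal_prod_rpow_le ht (by linarith) (by linarith)
    _ = 4 ^ n * 2 ^ (-(s * N)) * (2 ^ (1 / p * N) * iteratedRearrangement σ f t) := by
        rw [show (1 / p - s) * N = -(s * N) + 1 / p * N by ring,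
          ENNReal.rpow_add _ _ two_ne_zero ENNReal.ofNat_ne_top]
        ring
    _ ≤ 4 ^ n * 2 ^ (-(s * N)) * ((1 - 2 ^ (-ε))⁻¹ * geomMajorant ε s lam _ ν) := by gcongr
    _ = 4 ^ n * (1 - 2 ^ (-ε))⁻¹ * (2 ^ (-(s * N) + s * N) * ∏ k, _) := by
        rw [geomMajorant, ENNReal.rpow_add _ _ two_ne_zero ENNReal.ofNat_ne_top]
        ring
    _ = _ := by rw [neg_add_cancel, ENNReal.rpow_zero, one_mul]

lemma lintegral_posOrthant_div_prod_le {H : (Fin n → ℝ) → ℝ≥0∞} {P : (Fin n → ℤ) → ℝ≥0∞}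
    (hHP : ∀ ν, ∀ t ∈ dyadicBox (ν + 1), H t ≤ P ν) :
    ∫⁻ t in posOrthant n, H t / ENNReal.ofReal (∏ i, t i) ≤ ∑' ν, P ν := by
  calc _ ≤ ∫⁻ t in ⋃ ν : Fin n → ℤ, dyadicBox ν, H t / ENNReal.ofReal (∏ i, t i) :=
        lintegral_mono_set posOrthant_subset_iUnion_dyadicBox
    _ ≤ ∑' ν : Fin n → ℤ, ∫⁻ t in dyadicBox ν, H t / ENNReal.ofReal (∏ i, t i) :=
        lintegral_iUnion_le _ _
    _ = ∑' ν : Fin n → ℤ, ∫⁻ t in dyadicBox (ν + 1), H t / ENNReal.ofReal (∏ i, t i) :=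
        ((Equiv.addRight (1 : Fin n → ℤ)).tsum_eq fun ν =>
          ∫⁻ t in dyadicBox ν, H t / ENNReal.ofReal (∏ i, t i)).symm
    _ ≤ _ := by
        refine ENNReal.tsum_le_tsum fun ν => ?_
        set V : ℝ := ∏ i, (2 : ℝ) ^ (ν + 1 : Fin n → ℤ) i with hV
        have hV0 : 0 < V := Finset.prod_pos fun i _ => by positivity
        calc _ ≤ ∫⁻ _ in dyadicBox (ν + 1), P ν / ENNReal.ofReal V := by
              refine setLIntegral_mono' (measurableSet_dyadicBox _) fun t ht => ?_
              refine ENNReal.div_le_div (hHP ν t ht) (ENNReal.ofReal_le_ofReal ?_)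
              exact Finset.prod_le_prod (fun i _ => by positivity) fun i _ =>
                (ht i (mem_univ i)).1
          _ = P ν := by
              rw [setLIntegral_const, volume_dyadicBox, ← hV]
              exact ENNReal.div_mul_cancel (ENNReal.ofReal_pos.2 hV0).ne' ENNReal.ofReal_ne_top

lemma measurableSet_posOrthant : MeasurableSet (posOrthant n) := by
  simp only [posOrthant, measurableSet_setOfPred]
  fun_prop

lemma modLorentzNorm_le_of_lpSumLe {q : ℝ} {r M : ℝ≥0∞} (hr : r ≠ 0) {σ : Equiv.Perm (Fin n)}
    {f : (Fin n → ℝ) → ℝ} {P : (Fin n → ℤ) → ℝ≥0∞} (hP : LpSumLe r P M)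
    (hbound : ∀ ν, ∀ t ∈ dyadicBox (ν + 1),
      ENNReal.ofReal ((∏ i, t i) ^ (1 / q)) * iteratedRearrangement σ f t ≤ P ν) :
    modLorentzNorm q r σ f ≤ M := by
  unfold LpSumLe at hP
  unfold modLorentzNorm
  split_ifs at hP ⊢ with htop
  · refine essSup_le_of_ae_le _ ((ae_restrict_iff' measurableSet_posOrthant).2 (.of_forall ?_))
    intro t ht
    obtain ⟨ν, hν⟩ := mem_iUnion.1 (posOrthant_subset_iUnion_dyadicBox ht)
    rw [← sub_add_cancel ν 1] at hν
    exact (hbound _ t hν).trans (hP _)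
  · have hr0 : 0 < r.toReal := ENNReal.toReal_pos hr htop
    rw [one_div r.toReal, ENNReal.rpow_inv_le_iff hr0]
    exact (lintegral_posOrthant_div_prod_le fun ν t ht =>
      ENNReal.rpow_le_rpow (hbound ν t ht) hr0.le).trans hP

/-- The constant of the embedding for the decay rate `ε` of the lattice weights. -/
noncomputable def embeddingConstant (n : ℕ) (ε : ℝ) : ℝ≥0∞ :=
  4 ^ n * (1 - 2 ^ (-ε))⁻¹ * ((∑' ξ : Fin n → ℤ, latticeWeight ε ξ) * 192)

lemma embeddingConstant_ne_top (n : ℕ) {ε : ℝ} (hε : 0 < ε) : embeddingConstant n ε ≠ ∞ := by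
  have hgap : (1 : ℝ≥0∞) - 2 ^ (-ε) ≠ 0 := (tsub_pos_of_lt
    (ENNReal.rpow_lt_one_of_one_lt_of_neg (by norm_num) (neg_lt_zero.2 hε))).ne'
  exact ENNReal.mul_ne_top (ENNReal.mul_ne_top (by finiteness) (ENNReal.inv_ne_top.2 hgap))
    (ENNReal.mul_ne_top (tsum_latticeWeight_ne_top hε) (by finiteness))

lemma modLorentzNorm_le_of_measurable {f : (Fin n → ℝ) → ℝ} (hf : Measurable f)
    (σ : Equiv.Perm (Fin n)) {ε p q s : ℝ} {lam β : Fin n → ℝ} {θ : Fin n → ℝ≥0∞} {θm : ℝ≥0∞}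
    (hp : 1 ≤ p) (hfp : ∫⁻ x, ‖f x‖ₑ ^ p ≠ ∞) (hε : 0 < ε) (hβ : ∀ k, β k < 1)
    (hθ : ∀ k, ENNReal.ofReal p ≤ θ k) (hlam : ∀ k, 0 ≤ lam k) (hsum : ∑ k, lam k = 1)
    (hs0 : 0 ≤ s) (hs : ∀ k, lam k * β k = s) (hq : 1 / q = 1 / p - s) (hqε : 2 * ε ≤ 1 / q)
    (hθm : θm⁻¹ = ∑ k, ENNReal.ofReal (lam k) * (θ k)⁻¹) :
    modLorentzNorm q θm σ f ≤ embeddingConstant n ε *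
      ∏ k, (ENNReal.ofReal ((1 - β k) ^ (1 / θ k).toReal) *
        besovSeminorm (β k) p (θ k) k f) ^ lam k := by
  have hθ1 : ∀ k, 1 ≤ θ k := fun k => (ENNReal.one_le_ofReal.2 hp).trans (hθ k)
  have hθ0 : ∀ k, θ k ≠ 0 := fun k => (zero_lt_one.trans_le (hθ1 k)).ne'
  have hθm0 : θm ≠ 0 := by
    rw [← ENNReal.inv_ne_top, hθm]
    exact ENNReal.sum_ne_top.2 fun k _ =>
      ENNReal.mul_ne_top ENNReal.ofReal_ne_top (ENNReal.inv_ne_top.2 (hθ0 k))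
  have hnorm := (LpSumLe.prod_rpow hθ0 (fun k =>
    (lpSumLe_scaledGapNorm hf σ k hp (hθ k) (hβ k)).slowMajorant hε.le (hθ1 k)) hlam hθm).const_mul
      (4 ^ n * (1 - 2 ^ (-ε))⁻¹)
  simp only [← mul_assoc (∑' ξ : Fin n → ℤ, latticeWeight ε ξ)] at hnorm
  rw [prod_const_mul_rpow _ _ hlam hsum, ← mul_assoc, ← embeddingConstant] at hnorm
  refine modLorentzNorm_le_of_lpSumLe hθm0 hnorm fun ν t ht => ?_
  rw [hq]
  exact iteratedRearrangement_le_prod_slowMajorant hf σ hp hfp hε hlam hsum hs0 hs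
    (by linarith) ht

end Embedding

section Exponents

variable {n : ℕ} {β : Fin n → ℝ} {b : ℝ}

lemma inv_meanExponent_eq [NeZero n] (hβ : ∀ j, 0 < β j) (hb : 0 < b) (θ : Fin n → ℝ≥0∞) :
    (ENNReal.ofReal (n / b) * (∑ j, 1 / (ENNReal.ofReal (β j) * θ j))⁻¹)⁻¹ =
      ∑ j, ENNReal.ofReal (b / (n * β j)) * (θ j)⁻¹ := by
  have hn : (0 : ℝ) < n := Nat.cast_pos'.2 (NeZero.pos n)
  have hnb : 0 < n / b := div_pos hn hb
  rw [ENNReal.mul_inv (Or.inl (ENNReal.ofReal_pos.2 hnb).ne') (Or.inl ENNReal.ofReal_ne_top),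
    inv_inv, Finset.mul_sum]
  refine Finset.sum_congr rfl fun j _ => ?_
  rw [one_div, ENNReal.mul_inv (Or.inl (ENNReal.ofReal_pos.2 (hβ j)).ne')
    (Or.inl ENNReal.ofReal_ne_top), ← mul_assoc, ← ENNReal.ofReal_inv_of_pos hnb,
    ← ENNReal.ofReal_inv_of_pos (hβ j), ← ENNReal.ofReal_mul (by positivity), inv_div,
    ← div_eq_mul_inv (b / n), div_div]

lemma harmonicMean_pos [NeZero n] (hβ : ∀ j, 0 < β j) : 0 < n * (∑ j, 1 / β j)⁻¹ := by
  have hn : (0 : ℝ) < n := Nat.cast_pos'.2 (NeZero.pos n)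
  have : 0 < ∑ j, 1 / β j :=
    Finset.sum_pos (fun j _ => one_div_pos.2 (hβ j)) Finset.univ_nonempty
  positivity

lemma sum_harmonicMean_div_eq_one (hn : (n : ℝ) ≠ 0) (hb0 : b ≠ 0)
    (hb : b = n * (∑ j, 1 / β j)⁻¹) : ∑ j, b / (n * β j) = 1 := by
  have hsum : ∑ j, 1 / β j ≠ 0 := fun h => hb0 (by rw [hb, h, inv_zero, mul_zero])
  calc ∑ j, b / (n * β j) = b / n * ∑ j, 1 / β j := by
        rw [Finset.mul_sum]
        exact Finset.sum_congr rfl fun j _ => by rw [div_mul_div_comm, mul_one]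
    _ = 1 := by
        rw [hb]
        field_simp

lemma one_div_limitingExponent_eq {N p b : ℝ} (hN : N ≠ 0) (hp : p ≠ 0) :
    1 / (N * p / (N - b * p)) = 1 / p - b / N := by
  rw [one_div_div]
  field_simp

end Exponents

section Reduction

variable {n : ℕ}

lemma modLorentzNorm_le_of_memLp {f : (Fin n → ℝ) → ℝ} {p : ℝ} (hp : 1 ≤ p)
    (hf : MemLp f (ENNReal.ofReal p) volume) (σ : Equiv.Perm (Fin n)) {ε q s : ℝ}
    {lam β : Fin n → ℝ} {θ : Fin n → ℝ≥0∞} {θm : ℝ≥0∞} (hε : 0 < ε) (hβ : ∀ k, β k < 1)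
    (hθ : ∀ k, ENNReal.ofReal p ≤ θ k) (hlam : ∀ k, 0 ≤ lam k) (hsum : ∑ k, lam k = 1)
    (hs0 : 0 ≤ s) (hs : ∀ k, lam k * β k = s) (hq : 1 / q = 1 / p - s) (hqε : 2 * ε ≤ 1 / q)
    (hθm : θm⁻¹ = ∑ k, ENNReal.ofReal (lam k) * (θ k)⁻¹) :
    modLorentzNorm q θm σ f ≤ embeddingConstant n ε *
      ∏ k, (ENNReal.ofReal ((1 - β k) ^ (1 / θ k).toReal) *
        besovSeminorm (β k) p (θ k) k f) ^ lam k := by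
  have hp0 : 0 < p := by positivity
  obtain ⟨g, hg, hfg⟩ := hf.1.aemeasurable
  have hgp := (lintegral_rpow_enorm_lt_top_of_eLpNorm_lt_top (ENNReal.ofReal_pos.2 hp0).ne'
    ENNReal.ofReal_ne_top (hf.ae_eq hfg).2).ne
  rw [ENNReal.toReal_ofReal hp0.le] at hgp
  simp only [modLorentzNorm_congr_ae hfg, besovSeminorm_congr_ae hfg]
  exact modLorentzNorm_le_of_measurable hg σ hp hgp hε hβ hθ hlam hsum hs0 hs hq hqε hθm

end Reduction

end AnisoBesov

theorem theorem5p1_general (n : ℕ) [NeZero n] (Q : ℝ) :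
    ∃ c : ℝ, 0 < c ∧
      ∀ (p : ℝ) (θ : Fin n → ℝ≥0∞) (β : Fin n → ℝ) (βm : ℝ) (θm : ℝ≥0∞) (q : ℝ),
        1 ≤ p →
        (∀ j, ENNReal.ofReal p ≤ θ j) →
        (∀ j, 0 < β j ∧ β j < 1) →
        βm = n * (∑ j, 1 / β j)⁻¹ →
        θm = ENNReal.ofReal (n / βm) * (∑ j, 1 / (ENNReal.ofReal (β j) * θ j))⁻¹ →
        p < n / βm →
        q = n * p / (n - βm * p) →
        q ≤ Q →
        ∀ f : (Fin n → ℝ) → ℝ,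
          MemLp f (ENNReal.ofReal p) volume →
          ∀ σ : Equiv.Perm (Fin n),
            modLorentzNorm q θm σ f ≤
              ENNReal.ofReal c *
                ∏ j, (ENNReal.ofReal ((1 - β j) ^ (1 / θ j).toReal) *
                  besovSeminorm (β j) p (θ j) j f) ^ (βm / (n * β j)) := by
  have hn : (0 : ℝ) < n := Nat.cast_pos'.2 (NeZero.pos n)
  set ε : ℝ := 1 / (2 * max Q 1)
  have hε : 0 < ε := by positivity
  refine ⟨(embeddingConstant n ε).toReal + 1, by positivity, ?_⟩
  intro p θ β βm θm q hp hθ hβ hβm hθm hpβ hq hqQ f hf σ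
  have hp0 : 0 < p := by positivity
  have hβ0 : ∀ j, 0 < β j := fun j => (hβ j).1
  have hβm0 : 0 < βm := hβm ▸ harmonicMean_pos hβ0
  have hq0 : 0 < q := by
    have : 0 < n - βm * p := by linarith [(lt_div_iff₀' hβm0).1 hpβ]
    rw [hq]
    positivity
  have hqε : 2 * ε ≤ 1 / q :=
    calc 2 * ε = 1 / max Q 1 := by simp only [ε]; field_simp
      _ ≤ 1 / q := one_div_le_one_div_of_le hq0 (hqQ.trans (le_max_left Q 1))
  have hC := embeddingConstant_ne_top n hε
  refine (modLorentzNorm_le_of_memLp hp hf σ hε (fun j => (hβ j).2) hθ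
    (lam := fun j => βm / (n * β j)) (fun j => by have := hβ0 j; positivity)
    (sum_harmonicMean_div_eq_one hn.ne' hβm0.ne' hβm) (div_nonneg hβm0.le hn.le)
    (fun j => by have := hβ0 j; field_simp) (hq ▸ one_div_limitingExponent_eq hn.ne' hp0.ne') hqε
    (hθm ▸ inv_meanExponent_eq hβ0 hβm0 θ)).trans (mul_le_mul_left ?_ _)
  exact (ENNReal.le_ofReal_iff_toReal_le hC (by positivity)).2 (by linarith)

theorem theorem5p1 (n : ℕ) (hn : 2 ≤ n) (Q : ℝ) :
    ∃ c : ℝ, 0 < c ∧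
      ∀ (p : ℝ) (θ : Fin n → ℝ≥0∞) (β : Fin n → ℝ) (βm : ℝ) (θm : ℝ≥0∞) (q : ℝ),
        1 ≤ p →
        (∀ j, ENNReal.ofReal p ≤ θ j) →
        (∀ j, 0 < β j ∧ β j < 1) →
        βm = n * (∑ j, 1 / β j)⁻¹ →
        θm = ENNReal.ofReal (n / βm) * (∑ j, 1 / (ENNReal.ofReal (β j) * θ j))⁻¹ →
        p < n / βm →
        q = n * p / (n - βm * p) →
        q ≤ Q →
        ∀ f : (Fin n → ℝ) → ℝ,
          (∀ j, MemBesov (β j) p (θ j) j f) →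
          ∀ σ : Equiv.Perm (Fin n),
            modLorentzNorm q θm σ f ≤
              ENNReal.ofReal c *
                ∏ j, (ENNReal.ofReal ((1 - β j) ^ (1 / θ j).toReal) *
                  besovSeminorm (β j) p (θ j) j f) ^ (βm / (n * β j)) := by
  have : NeZero n := ⟨by omega⟩
  obtain ⟨c, hc, h⟩ := theorem5p1_general n Q
  exact ⟨c, hc, fun p θ β βm θm q hp hθ hβ hβm hθm hpβ hq hqQ f hf =>
    h p θ β βm θm q hp hθ hβ hβm hθm hpβ hq hqQ f (hf 0).1⟩
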